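/- **Setting.** Let $p$ be a prime and $P$ a finite $p$-group. A *$P$-category* $\mathcal F$ has all subgroups of $P$ as objects; the set $\mathcal F(Q,R)$ of morphisms $R\to Q$ consists of injective group homomorphisms, contains those induced by conjugation by elements of $P$, and composition is composition of maps. For $K\le \mathrm{Aut}(Q)$ let $N_P^K(Q)$ be the group of elements of $N_P(Q)$ acting on $Q$ as elements of $K$; $Q$ is *fully $K$-normalized* in $\mathcal F$ if $\psi(N_P^K(Q))=N_P^{{}^{\psi}K}(\psi(Q))$ for every $\psi\in\mathcal F(P,Q\cdot N_P^K(Q))$, and *fully normalized* if this holds for $K=\mathrm{Aut}(Q)$. $\mathcal F$ is a *Frobenius $P$-category* if (i) for $\varphi\in\mathcal F(Q,R)$ and a group homomorphism $\psi:T\to R$, $\varphi\circ\psi\in\mathcal F(Q,T)$ implies $\psi\in\mathcal F(R,T)$; (ii) the inner automorphisms of $P$ form a Sylow $p$-subgroup of $\mathcal F(P)=\mathcal F(P,P)$; (iii) for $\varphi\in\mathcal F(P,Q)$ and $K\le\mathrm{Aut}(Q)$ with $\varphi(Q)$ fully ${}^{\varphi}K$-normalized, there are $\psi\in\mathcal F(P,Q\cdot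 N_P^K(Q))$ and $\chi\in K$ with $\psi|_Q=\varphi\circ\chi$. A subgroup $Q\le P$ is *$\mathcal F$-selfcentralizing* if $C_P(\varphi(Q))\le\varphi(Q)$ for all $\varphi\in\mathcal F(P,Q)$. For $V\le P$, the *normalizer* $N_{\mathcal F}(V)$ is the $N_P(V)$-category whose morphisms $T\to R$ are the $\mathcal F$-morphisms that extend to an $\mathcal F$-morphism $T\cdot V\to R\cdot V$ mapping $V$ onto $V$. Let $\mathcal F$ be a Frobenius $P$-category and $\mathfrak X$ a nonempty set of $\mathcal F$-selfcentralizing subgroups of $P$ containing every subgroup of $P$ that admits an $\mathcal F$-morphism from a member of $\mathfrak X$; let $\mathcal F^{\mathfrak X}$ be the full subcategory of $\mathcal F$ over $\mathfrak X$. An *$\mathcal F^{\mathfrak X}$-locality* is a finite category $\mathcal L$ with object set $\mathfrak X$, with functors $\tau:\mathcal T_P^{\mathfrak X}\to\mathcal L$ and $\pi:\mathcal L\to\mathcal F^{\mathfrak X}$ that are the identity on objects, where $\mathcal T_P^{\mathfrak X}(Q,R)=\{u\in P: uRu^{-1}\le Q\}$ with the product of $P$ as composition, $\pi$ is full, and $\pi\circ\tau$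 is given by conjugation. An *$\mathcal F^{\mathfrak X}$-locality isomorphism* is an isomorphism of categories that is the identity on objects and compatible with $\tau$ and $\pi$. $\mathcal L$ is *divisible* if for all $x:R\to Q$ and $y:T\to Q$ in $\mathcal L$ with $\mathrm{Im}\,\pi(y)\subseteq\mathrm{Im}\,\pi(x)$ there is a unique $z:T\to R$ with $x\cdot z=y$. Let $W\le P$ be $\mathcal F$-selfcentralizing and fully normalized in $\mathcal F$. An *$\mathcal F$-localizer* of $W$ is a finite group $L$ with an injective homomorphism $\tau:N_P(W)\to L$ and a surjective one $\pi:L\to\mathcal F(W)$ such that $\tau(N_P(W))$ is a Sylow $p$-subgroup of $L$, $\mathrm{Ker}\,\pi=\tau(Z(W))$, $\pi\circ\tau$ is given by conjugation, $e\,\tau(w)\,e^{-1}=\tau(\pi(e)(w))$ for $e\in L$, $w\in W$, and, for all $T,R\le N_P(W)$, the $N_{\mathcal F}(W)$-morphisms $T\to R$ are exactly the homomorphisms that become conjugation by some element of $L$ via $\tau$. For a set $\mathfrak Y$ of subgroups of $N_P(W)$, its *transporter* $\mathcal T_L^{\mathfrak Y}$ over $\mathfrak Y$ has $\mathcal T_L^{\mathfrak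 Y}(R,T)=\{e\in L: e\tau(T)e^{-1}\le\tau(R)\}$, the product of $L$ as composition, and the structural functors given by $\tau$ and by conjugation in $L$. A *perfect* $\mathcal F^{\mathfrak X}$-locality is a divisible $\mathcal F^{\mathfrak X}$-locality $\mathcal P^{\mathfrak X}$ such that, for every $Q\in\mathfrak X$ fully normalized in $\mathcal F$, the group $\mathcal P^{\mathfrak X}(Q)$ of automorphisms of $Q$, with $\tau_Q:N_P(Q)\to\mathcal P^{\mathfrak X}(Q)$ and $\pi_Q:\mathcal P^{\mathfrak X}(Q)\to\mathcal F(Q)$, is an $\mathcal F$-localizer of $Q$. For $V\le P$ put $\mathfrak X^V=\{T\in\mathfrak X: T\le N_P(V)\}$ and $\mathcal F^{\mathfrak X,V}=N_{\mathcal F}(V)^{\mathfrak X^V}$, and let the *normalizer* $\mathcal P^{\mathfrak X,V}=N_{\mathcal P^{\mathfrak X}}(V)$ be the category over $\mathfrak X^V$, with the structural functors inherited from $\mathcal P^{\mathfrak X}$, whose morphisms $T\to R$ are the $\mathcal P^{\mathfrak X}$-morphisms $x:T\to R$ for which there is a $\mathcal P^{\mathfrak X}$-morphism $\hat x:T\cdot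 V\to R\cdot V$ with $\pi(\hat x)(V)=V$ and $\hat x\cdot\tau_{T\cdot V,T}(1)=\tau_{R\cdot V,R}(1)\cdot x$. A perfect $\mathcal F^{\mathfrak X}$-locality $\mathcal P^{\mathfrak X}$ is *extendable* if for every $\mathcal F$-selfcentralizing $W\le P$, fully normalized in $\mathcal F$, with $N_P(W)\in\mathfrak X$, there is an $\mathcal F^{\mathfrak X,W}$-locality isomorphism $\mathcal P^{\mathfrak X,W}\cong\mathcal T_L^{\mathfrak X^W}$, where $L$ is an $\mathcal F$-localizer of $W$. **Proposition.** Let $\mathcal P^{\mathfrak X}$ be an extendable perfect $\mathcal F^{\mathfrak X}$-locality and let $V$ be an $\mathcal F$-selfcentralizing subgroup of $P$, fully normalized in $\mathcal F$, with $N_P(V)\in\mathfrak X$. Then $N_{\mathcal F}(V)$ is a Frobenius $N_P(V)$-category; $\mathfrak X^V$ is a nonempty set of $N_{\mathcal F}(V)$-selfcentralizing subgroups of $N_P(V)$ containing every subgroup of $N_P(V)$ that admits an $N_{\mathcal F}(V)$-morphism from a member of $\mathfrak X^V$; and $\mathcal P^{\mathfrak X,V}$ is an extendable perfect $\mathcal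 F^{\mathfrak X,V}$-locality. -/

import Mathlib

/-!
Throughout, the finite `p`-group `P` is given as a subgroup of a group `G` (one may take `G = P`,
`P = ⊤`).  So the subgroups of `P` and of `N_P(V)` are all subgroups of `G` contained in `P`,
resp. in `N_P(V)`, and passing to a normalizer does not change the type of the objects.
-/

universe u v

namespace Puig

variable {G : Type u} [Group G]

/-- The normalizer `N_P(V)`. -/
def normP (P V : Subgroup G) : Subgroup G := P ⊓ Subgroup.normalizer (V : Set G)

/-- The `P`-transporter from `R` to `Q`: the elements `u` of `P` with `u R u⁻¹ ≤ Q`. -/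
def transporter (P R Q : Subgroup G) : Set G := {u | u ∈ P ∧ ∀ r ∈ R, u * r * u⁻¹ ∈ Q}

/-- The group homomorphism `R → Q` given by conjugation by a transporter element. -/
def conjHom {P R Q : Subgroup G} (u : transporter P R Q) : R →* Q :=
  MonoidHom.mk' (fun r => ⟨u * r * (u : G)⁻¹, u.2.2 r r.2⟩) (fun a b => by
    ext; simp [mul_assoc])

theorem one_mem_transporter {P R Q : Subgroup G} (h : R ≤ Q) : (1 : G) ∈ transporter P R Q :=
  ⟨P.one_mem, fun r hr => by simpa using h hr⟩

theorem mul_mem_transporter {P T R Q : Subgroup G} {u w : G} (hu : u ∈ transporter P R Q)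
    (hw : w ∈ transporter P T R) : u * w ∈ transporter P T Q :=
  ⟨P.mul_mem hu.1 hw.1, fun t ht => by
    have := hu.2 _ (hw.2 t ht)
    simpa [mul_assoc] using this⟩

theorem transporter_mono {P P' R Q : Subgroup G} (h : P ≤ P') {u : G}
    (hu : u ∈ transporter P R Q) : u ∈ transporter P' R Q := ⟨h hu.1, hu.2⟩

theorem sup_mem_transporter {P V R Q : Subgroup G} {u : G}
    (hu : u ∈ transporter (normP P V) R Q) : u ∈ transporter P (R ⊔ V) (Q ⊔ V) := by
  refine ⟨hu.1.1, fun r hr => ?_⟩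
  have h : R ⊔ V ≤ (Q ⊔ V).comap (MulAut.conj u).toMonoidHom := by
    refine sup_le (fun x hx => ?_) (fun x hx => ?_)
    · exact (le_sup_left : Q ≤ Q ⊔ V) (hu.2 x hx)
    · exact (le_sup_right : V ≤ Q ⊔ V) ((Subgroup.mem_normalizer_iff.1 hu.1.2 x).1 hx)
  exact h hr

/-- A `P`-category: the objects are the subgroups of `P`, and the set `Hom R Q` of morphisms from
`R` to `Q` consists of injective group homomorphisms, contains all those induced by conjugation in
`P` and is stable under composition.  (`Hom R Q` is empty unless `R` and `Q` are contained
in `P`.) -/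
structure PCategory (P : Subgroup G) where
  Hom : (R Q : Subgroup G) → Set (R →* Q)
  le_dom : ∀ {R Q : Subgroup G} {φ : R →* Q}, φ ∈ Hom R Q → R ≤ P
  le_cod : ∀ {R Q : Subgroup G} {φ : R →* Q}, φ ∈ Hom R Q → Q ≤ P
  injective : ∀ {R Q : Subgroup G} {φ : R →* Q}, φ ∈ Hom R Q → Function.Injective φ
  conj_mem : ∀ {R Q : Subgroup G}, R ≤ P → Q ≤ P → ∀ u : transporter P R Q, conjHom u ∈ Hom R Q
  comp_mem : ∀ {T R Q : Subgroup G} {φ : R →* Q} {ψ : T →* R},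
    φ ∈ Hom R Q → ψ ∈ Hom T R → φ.comp ψ ∈ Hom T Q

namespace PCategory

variable {P : Subgroup G} (F : PCategory P)

theorem id_mem {Q : Subgroup G} (hQ : Q ≤ P) : MonoidHom.id Q ∈ F.Hom Q Q := by
  have h := F.conj_mem hQ hQ ⟨1, one_mem_transporter le_rfl⟩
  convert h using 1
  ext q
  simp [conjHom]

/-- Divisibility: `φ ∘ ψ` is a morphism only if `ψ` is. -/
def IsDivisible : Prop :=
  ∀ {T R Q : Subgroup G} (φ : R →* Q) (ψ : T →* R),
    φ ∈ F.Hom R Q → φ.comp ψ ∈ F.Hom T Q → ψ ∈ F.Hom T R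

/-- The group `F(P)` of automorphisms of `P` in `F`. -/
def autTop : Subgroup (MulAut P) where
  carrier := {α | (α : P ≃* P).toMonoidHom ∈ F.Hom P P ∧
    ((α⁻¹ : MulAut P) : P ≃* P).toMonoidHom ∈ F.Hom P P}
  one_mem' := ⟨F.id_mem le_rfl, F.id_mem le_rfl⟩
  mul_mem' := fun {a b} ha hb => by
    refine ⟨F.comp_mem ha.1 hb.1, ?_⟩
    have h := F.comp_mem hb.2 ha.2
    convert h using 1
    ext x
    simp
  inv_mem' := fun {a} ha => ⟨ha.2, by simpa using ha.1⟩

/-- The group `N_P^K(Q)` of the elements of `P` which normalize `Q` and act on it as an element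
of `K ≤ Aut(Q)`. -/
def normK (P Q : Subgroup G) (K : Subgroup (MulAut Q)) : Subgroup G where
  carrier := {y | y ∈ P ∧ ∃ χ ∈ K, ∀ q : Q, y * q * y⁻¹ = χ q}
  one_mem' := ⟨P.one_mem, 1, K.one_mem, fun q => by simp⟩
  mul_mem' := by
    rintro a b ⟨ha, χ, hχ, h⟩ ⟨hb, χ', hχ', h'⟩
    refine ⟨P.mul_mem ha hb, χ * χ', K.mul_mem hχ hχ', fun q => ?_⟩
    rw [MulAut.mul_apply, ← h, ← h']
    simp [mul_assoc]
  inv_mem' := by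
    rintro a ⟨ha, χ, hχ, h⟩
    refine ⟨P.inv_mem ha, χ⁻¹, K.inv_mem hχ, fun q => ?_⟩
    have := h (χ⁻¹ q)
    rw [MulAut.apply_inv_self] at this
    rw [← this]
    simp [mul_assoc]

/-- `Q` is fully `K`-normalized in `F`: for every `F`-morphism `ψ : Q · N_P^K(Q) → P`, the image
`ψ(N_P^K(Q))` is the whole of `N_P^{K'}(ψ(Q))`, where `K' ≤ Aut(ψ(Q))` corresponds to `K`
via `ψ`. -/
def IsFullyKNormalized (Q : Subgroup G) (K : Subgroup (MulAut Q)) : Prop :=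
  Q ≤ P ∧ ∀ ψ ∈ F.Hom (Q ⊔ normK P Q K) P, ∀ y : P,
    (∃ w : ↥(Q ⊔ normK P Q K), (w : G) ∈ normK P Q K ∧ ψ w = y) ↔
      ∃ χ ∈ K, ∀ q : Q, y * ψ ⟨q, (le_sup_left : Q ≤ Q ⊔ normK P Q K) q.2⟩ * y⁻¹ =
        ψ ⟨χ q, (le_sup_left : Q ≤ Q ⊔ normK P Q K) (χ q).2⟩

/-- `Q` is fully normalized in `F`. -/
def IsFullyNormalized (Q : Subgroup G) : Prop := F.IsFullyKNormalized Q ⊤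

/-- `Q` is `F`-selfcentralizing: `C_P(φ(Q)) ≤ φ(Q)` for every `F`-morphism `φ : Q → P`. -/
def IsSelfcentralizing (Q : Subgroup G) : Prop :=
  Q ≤ P ∧ ∀ φ ∈ F.Hom Q P, ∀ y : P, (∀ q : Q, y * φ q = φ q * y) → ∃ q : Q, φ q = y

/-- `F` is a Frobenius `P`-category. -/
structure IsFrobenius (p : ℕ) : Prop where
  divisible : F.IsDivisible
  /-- The inner automorphisms of `P` form a Sylow `p`-subgroup of `F(P)`. -/
  sylow : ∃ S : Sylow p F.autTop,
    (S : Subgroup F.autTop).map F.autTop.subtype = (MulAut.conj : P →* MulAut P).range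
  /-- If `φ` is an `F`-morphism with image `Q'`, and `Q'` is fully `K'`-normalized for the group
  `K'` corresponding to `K ≤ Aut(Q)` via `φ`, then `φ ∘ χ` extends to `Q · N_P^K(Q)` for
  some `χ ∈ K`. -/
  extension : ∀ (Q Q' : Subgroup G) (φ : Q ≃* Q') (K : Subgroup (MulAut Q)),
    φ.toMonoidHom ∈ F.Hom Q Q' →
    F.IsFullyKNormalized Q' (K.map (MulAut.congr φ).toMonoidHom) →
    ∃ ψ ∈ F.Hom (Q ⊔ normK P Q K) P, ∃ χ ∈ K, ∀ q : Q,
      (ψ ⟨q, (le_sup_left : Q ≤ Q ⊔ normK P Q K) q.2⟩ : G) = φ (χ q)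

/-- The normalizer `N_F(V)`, an `N_P(V)`-category: its morphisms `T → R` are the `F`-morphisms
that extend to an `F`-morphism `T · V → R · V` stabilizing `V`.  (The latter is injective and `V`
is finite in all uses, so that mapping `V` into `V` means mapping it onto `V`.) -/
def normalizer (V : Subgroup G) (hV : V ≤ P) : PCategory (normP P V) where
  Hom T R := {ψ | T ≤ normP P V ∧ R ≤ normP P V ∧ ψ ∈ F.Hom T R ∧ ∃ ξ ∈ F.Hom (T ⊔ V) (R ⊔ V),
    (∀ w : ↥(T ⊔ V), (w : G) ∈ V → (ξ w : G) ∈ V) ∧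
    ∀ t : T, (ξ ⟨t, (le_sup_left : T ≤ T ⊔ V) t.2⟩ : G) = ψ t}
  le_dom h := h.1
  le_cod h := h.2.1
  injective h := F.injective h.2.2.1
  conj_mem := fun {R Q} hR hQ u => by
    refine ⟨hR, hQ, F.conj_mem (hR.trans inf_le_left) (hQ.trans inf_le_left)
      ⟨u, transporter_mono inf_le_left u.2⟩,
      conjHom ⟨u, sup_mem_transporter u.2⟩, F.conj_mem (sup_le (hR.trans inf_le_left) hV)
        (sup_le (hQ.trans inf_le_left) hV) _, ?_, ?_⟩
    · intro w hw
      exact (Subgroup.mem_normalizer_iff.1 u.2.1.2 w).1 hw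
    · intro t
      rfl
  comp_mem := by
    rintro T R Q φ ψ ⟨-, hQ, hφ, ξ, hξ, hξV, hξφ⟩ ⟨hT, -, hψ, ζ, hζ, hζV, hζψ⟩
    refine ⟨hT, hQ, F.comp_mem hφ hψ, ξ.comp ζ, F.comp_mem hξ hζ,
      fun w hw => hξV _ (hζV w hw), fun t => ?_⟩
    have : ζ ⟨t, (le_sup_left : T ≤ T ⊔ V) t.2⟩ =
        ⟨ψ t, (le_sup_left : R ≤ R ⊔ V) (ψ t).2⟩ := Subtype.ext (hζψ t)
    rw [MonoidHom.comp_apply, this, hξφ]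
    rfl

/-- `X` is a nonempty set of `F`-selfcentralizing subgroups of `P` that contains every subgroup
of `P` admitting an `F`-morphism from some member of `X`. -/
structure IsUpClosed (X : Set (Subgroup G)) : Prop where
  nonempty : X.Nonempty
  selfcentralizing : ∀ Q ∈ X, F.IsSelfcentralizing Q
  up : ∀ Q ∈ X, ∀ (R : Subgroup G) (φ : Q →* R), φ ∈ F.Hom Q R → R ∈ X

theorem IsUpClosed.sup_mem {F : PCategory P} {X : Set (Subgroup G)} (hX : F.IsUpClosed X)
    {V : Subgroup G} (hV : V ≤ P) {T : Subgroup G} (hT : T ∈ X) : T ⊔ V ∈ X :=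
  have hTP : T ≤ P := (hX.selfcentralizing T hT).1
  hX.up T hT _ _ (F.conj_mem hTP (sup_le hTP hV) ⟨1, one_mem_transporter le_sup_left⟩)

end PCategory

/-- The set `X^V` of the members of `X` contained in `N_P(V)`. -/
def objNorm (P : Subgroup G) (X : Set (Subgroup G)) (V : Subgroup G) : Set (Subgroup G) :=
  {T | T ∈ X ∧ T ≤ normP P V}

/-- For an `F`-selfcentralizing subgroup `W` of `P`, fully normalized in `F`: the finite group `L`,
with `τ : N_P(W) → L` and `π : L → F(W)`, is an `F`-localizer of `W`. -/
structure IsLocalizer (p : ℕ) {P : Subgroup G} (F : PCategory P) (W : Subgroup G) (hW : W ≤ P)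
    (L : Type v) [Group L] (τ : ↥(normP P W) →* L) (π : L →* Monoid.End W) : Prop where
  finite : Finite L
  τ_injective : Function.Injective τ
  /-- `τ(N_P(W))` is a Sylow `p`-subgroup of `L`. -/
  sylow : ∃ S : Sylow p L, (S : Subgroup L) = τ.range
  /-- `π` maps `L` onto `F(W)`. -/
  range_π : ∀ φ : W →* W, φ ∈ F.Hom W W ↔ ∃ e : L, π e = φ
  /-- The kernel of `π` is `τ(Z(W))`. -/
  ker_π : ∀ e : L, π e = 1 ↔
    ∃ z : ↥(normP P W), (z : G) ∈ W ∧ (∀ w ∈ W, (z : G) * w = w * z) ∧ τ z = e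
  /-- `π ∘ τ` is given by conjugation. -/
  π_τ : ∀ (y : ↥(normP P W)) (w : W), ((π (τ y) : W →* W) w : G) = y * w * (y : G)⁻¹
  /-- `π` is given by conjugation on `τ(W)`. -/
  coherent : ∀ (e : L) (a b : ↥(normP P W)) (ha : (a : G) ∈ W),
    ((π e : W →* W) ⟨a, ha⟩ : G) = b → e * τ a * e⁻¹ = τ b
  /-- `L` induces `N_F(W)` on the subgroups of `N_P(W)`: the morphisms of `N_F(W)` are the maps
  that become conjugation by an element of `L` via `τ`. -/
  induces : ∀ (T R : Subgroup G) (hT : T ≤ normP P W) (hR : R ≤ normP P W) (φ : T →* R),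
    φ ∈ (F.normalizer W hW).Hom T R ↔
      ∃ e : L, ∀ t : T, e * τ ⟨t, hT t.2⟩ * e⁻¹ = τ ⟨φ t, hR (φ t).2⟩

/-- An `F^X`-locality: a finite category with `X` as its set of objects, with functors `τ` from the
full subcategory over `X` of the transporter category of `P`, and `π` to the full subcategory of
`F` over `X`; both are the identity on the objects, `π` is full, and `π ∘ τ` is given by conjugation
in `P`.  `Hom R Q` is the set of morphisms `R → Q`, and `comp x z` is the composite `x · z`. -/
structure Locality {P : Subgroup G} (F : PCategory P) (X : Set (Subgroup G)) where
  Hom : X → X → Type v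
  finite_hom : ∀ R Q : X, Finite (Hom R Q)
  id : ∀ Q : X, Hom Q Q
  comp : ∀ {T R Q : X}, Hom R Q → Hom T R → Hom T Q
  id_comp : ∀ {R Q : X} (x : Hom R Q), comp (id Q) x = x
  comp_id : ∀ {R Q : X} (x : Hom R Q), comp x (id R) = x
  assoc : ∀ {S T R Q : X} (x : Hom R Q) (y : Hom T R) (z : Hom S T),
    comp (comp x y) z = comp x (comp y z)
  τ : ∀ {R Q : X}, transporter P (R : Subgroup G) Q → Hom R Q
  τ_one : ∀ Q : X, τ ⟨1, one_mem_transporter (le_refl (Q : Subgroup G))⟩ = id Q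
  τ_mul : ∀ {T R Q : X} (a : transporter P (R : Subgroup G) Q)
    (b : transporter P (T : Subgroup G) R), τ ⟨a * b, mul_mem_transporter a.2 b.2⟩ =
      comp (τ a) (τ b)
  π : ∀ {R Q : X}, Hom R Q → ((R : Subgroup G) →* (Q : Subgroup G))
  π_mem : ∀ {R Q : X} (x : Hom R Q), π x ∈ F.Hom R Q
  π_id : ∀ Q : X, π (id Q) = MonoidHom.id _
  π_comp : ∀ {T R Q : X} (x : Hom R Q) (y : Hom T R), π (comp x y) = (π x).comp (π y)
  π_full : ∀ {R Q : X}, ∀ φ ∈ F.Hom (R : Subgroup G) Q, ∃ x : Hom R Q, π x = φ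
  π_τ : ∀ {R Q : X} (a : transporter P (R : Subgroup G) Q), π (τ a) = conjHom a

namespace Locality

variable {P : Subgroup G} {F : PCategory P} {X : Set (Subgroup G)}

/-- The morphism `R → Q` of an inclusion `R ≤ Q`. -/
def incl (L : Locality.{u, v} F X) {R Q : X} (h : (R : Subgroup G) ≤ Q) : L.Hom R Q :=
  L.τ ⟨1, one_mem_transporter h⟩

/-- Divisibility: if the image of `π(y)` is contained in the image of `π(x)` then there is a
unique `z` with `x · z = y`. -/
def IsDivisible (L : Locality.{u, v} F X) : Prop :=
  ∀ {T R Q : X} (x : L.Hom R Q) (y : L.Hom T Q), (L.π y).range ≤ (L.π x).range →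
    ∃! z : L.Hom T R, L.comp x z = y

instance endMonoid (L : Locality.{u, v} F X) (Q : X) : Monoid (L.Hom Q Q) where
  mul x y := L.comp x y
  mul_assoc := L.assoc
  one := L.id Q
  one_mul := L.id_comp
  mul_one := L.comp_id

/-- The group of automorphisms of the object `Q`.  (In a divisible locality all endomorphisms
of `Q` are invertible, because `Q` is finite.) -/
abbrev Aut (L : Locality.{u, v} F X) (Q : X) : Type v := (L.Hom Q Q)ˣ

/-- The group homomorphism `τ_Q` from `N_P(Q)` to the automorphism group of `Q`. -/
def τAut (L : Locality.{u, v} F X) (Q : X) : ↥(normP P (Q : Subgroup G)) →* L.Aut Q :=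
  MonoidHom.toHomUnits
    { toFun := fun a => L.τ ⟨a, a.2.1, fun r hr => (Subgroup.mem_normalizer_iff.1 a.2.2 r).1 hr⟩
      map_one' := L.τ_one Q
      map_mul' := fun a b => L.τ_mul (Q := Q) (R := Q) (T := Q)
        ⟨a, a.2.1, fun r hr => (Subgroup.mem_normalizer_iff.1 a.2.2 r).1 hr⟩
        ⟨b, b.2.1, fun r hr => (Subgroup.mem_normalizer_iff.1 b.2.2 r).1 hr⟩ }

/-- The group homomorphism `π_Q` from the automorphism group of `Q` to `F(Q)`. -/
def πAut (L : Locality.{u, v} F X) (Q : X) : L.Aut Q →* Monoid.End (Q : Subgroup G) where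
  toFun x := L.π (x : L.Hom Q Q)
  map_one' := L.π_id Q
  map_mul' x y := L.π_comp (x : L.Hom Q Q) (y : L.Hom Q Q)

/-- `L` is a perfect `F^X`-locality: it is divisible and, for every `Q` in `X` fully normalized
in `F`, the group of automorphisms of `Q` in `L`, with `τ_Q` and `π_Q`, is an `F`-localizer
of `Q`. -/
structure IsPerfect (p : ℕ) (L : Locality.{u, v} F X) : Prop where
  divisible : L.IsDivisible
  localizer : ∀ (Q : X) (hQ : F.IsFullyNormalized Q),
    IsLocalizer p F Q hQ.1 (L.Aut Q) (L.τAut Q) (L.πAut Q)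

/-- An `F^X`-locality isomorphism: an isomorphism of categories that is the identity on the objects
and is compatible with the functors `τ` and `π`. -/
structure Iso (L L' : Locality.{u, v} F X) where
  equiv : ∀ R Q : X, L.Hom R Q ≃ L'.Hom R Q
  map_id : ∀ Q : X, equiv Q Q (L.id Q) = L'.id Q
  map_comp : ∀ {T R Q : X} (x : L.Hom R Q) (y : L.Hom T R),
    equiv T Q (L.comp x y) = L'.comp (equiv R Q x) (equiv T R y)
  map_τ : ∀ {R Q : X} (a : transporter P (R : Subgroup G) Q), equiv R Q (L.τ a) = L'.τ a
  π_map : ∀ {R Q : X} (x : L.Hom R Q), L'.π (equiv R Q x) = L.π x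

section Normalizer

variable {V : Subgroup G}

/-- A member of `X^V` as an object of `X`. -/
abbrev obj (T : objNorm P X V) : X := ⟨T, T.2.1⟩

/-- The product `T · V` as an object of `X`, for `T` in `X^V`. -/
abbrev objSup (hX : F.IsUpClosed X) (hV : V ≤ P) (T : objNorm P X V) : X :=
  ⟨(T : Subgroup G) ⊔ V, hX.sup_mem hV T.2.1⟩

/-- The morphism `x : T → R` is induced by a morphism `T · V → R · V` which stabilizes `V`. -/
def Normalizes (L : Locality.{u, v} F X) (hX : F.IsUpClosed X) (hV : V ≤ P)
    {T R : objNorm P X V} (x : L.Hom (obj T) (obj R)) : Prop :=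
  ∃ x' : L.Hom (objSup hX hV T) (objSup hX hV R),
    (∀ w : ↥((T : Subgroup G) ⊔ V), (w : G) ∈ V → (L.π x' w : G) ∈ V) ∧
    L.comp x' (L.incl (R := obj T) le_sup_left) = L.comp (L.incl (R := obj R) le_sup_left) x

theorem π_incl (L : Locality.{u, v} F X) {R Q : X} (h : (R : Subgroup G) ≤ Q)
    (r : (R : Subgroup G)) : (L.π (L.incl h) r : G) = r := by
  rw [incl, L.π_τ]
  simp [conjHom]

theorem π_extends (L : Locality.{u, v} F X) (hX : F.IsUpClosed X) (hV : V ≤ P)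
    {T R : objNorm P X V} {x : L.Hom (obj T) (obj R)}
    {x' : L.Hom (objSup hX hV T) (objSup hX hV R)}
    (h : L.comp x' (L.incl (R := obj T) le_sup_left) =
      L.comp (L.incl (R := obj R) le_sup_left) x) (t : (T : Subgroup G)) :
    (L.π x' ⟨t, (le_sup_left : (T : Subgroup G) ≤ (T : Subgroup G) ⊔ V) t.2⟩ : G) =
      L.π x t := by
  have h1 := congrArg (fun z => (L.π z t : G)) h
  simp only [L.π_comp, MonoidHom.comp_apply] at h1
  rw [π_incl] at h1
  rw [← h1]
  congr 2
  exact Subtype.ext (L.π_incl (R := obj T) (Q := objSup hX hV T) le_sup_left t).symm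

theorem incl_τ (L : Locality.{u, v} F X) {T R Q S : X} (hR : (R : Subgroup G) ≤ Q)
    (hT : (T : Subgroup G) ≤ S) (a : transporter P (T : Subgroup G) R)
    (b : transporter P (S : Subgroup G) Q) (hab : (a : G) = b) :
    L.comp (L.τ b) (L.incl hT) = L.comp (L.incl hR) (L.τ a) := by
  rw [incl, incl, ← L.τ_mul, ← L.τ_mul]
  congr 1
  ext
  simp [hab]

/-- The normalizer of `V` in a divisible `F^X`-locality `L`, an `N_F(V)^{X^V}`-locality: the objects
are the members of `X^V`, and the morphisms are the `L`-morphisms `T → R` that are induced by an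
`L`-morphism `T · V → R · V` stabilizing `V`.  The group `V` itself need not belong to `X`. -/
def normalizer (L : Locality.{u, v} F X) (hX : F.IsUpClosed X) (hL : L.IsDivisible)
    (V : Subgroup G) (hV : V ≤ P) :
    Locality.{u, v} (F.normalizer V hV) (objNorm P X V) where
  Hom T R := {x : L.Hom (obj T) (obj R) // L.Normalizes hX hV x}
  finite_hom T R := by
    have := L.finite_hom (obj T) (obj R)
    infer_instance
  id Q := ⟨L.id _, L.id _, fun w hw => by rw [L.π_id]; exact hw, by
    rw [L.id_comp, L.comp_id]⟩
  comp x y := ⟨L.comp x.1 y.1, by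
    obtain ⟨x', hx, hx'⟩ := x.2
    obtain ⟨y', hy, hy'⟩ := y.2
    refine ⟨L.comp x' y', fun w hw => ?_, ?_⟩
    · rw [L.π_comp]
      exact hx _ (hy w hw)
    · rw [L.assoc, hy', ← L.assoc, hx', L.assoc]⟩
  id_comp x := Subtype.ext (L.id_comp _)
  comp_id x := Subtype.ext (L.comp_id _)
  assoc x y z := Subtype.ext (L.assoc _ _ _)
  τ {R Q} a := ⟨L.τ (R := obj R) (Q := obj Q) ⟨a, transporter_mono inf_le_left a.2⟩,
    L.τ (R := objSup hX hV R) (Q := objSup hX hV Q) ⟨a, sup_mem_transporter a.2⟩,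
    fun w hw => by
      rw [L.π_τ]
      exact (Subgroup.mem_normalizer_iff.1 a.2.1.2 w).1 hw,
    L.incl_τ _ _ _ _ rfl⟩
  τ_one Q := Subtype.ext (L.τ_one _)
  τ_mul {T R Q} a b := Subtype.ext (L.τ_mul (T := obj T) (R := obj R) (Q := obj Q)
    ⟨a, transporter_mono inf_le_left a.2⟩ ⟨b, transporter_mono inf_le_left b.2⟩)
  π x := L.π x.1
  π_mem {R Q} x := by
    obtain ⟨x', hx, hx'⟩ := x.2
    exact ⟨R.2.2, Q.2.2, L.π_mem x.1, L.π x', L.π_mem x', hx, L.π_extends hX hV hx'⟩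
  π_id Q := L.π_id _
  π_comp x y := L.π_comp _ _
  π_full {R Q} φ hφ := by
    obtain ⟨-, -, -, ξ, hξ, hξV, hξφ⟩ := hφ
    obtain ⟨x', hx'⟩ := L.π_full (R := objSup hX hV R) (Q := objSup hX hV Q) ξ hξ
    have key : ∀ r : (R : Subgroup G),
        (L.π (L.comp x' (L.incl (R := obj R) (Q := objSup hX hV R) le_sup_left)) r : G) =
          φ r := by
      intro r
      rw [L.π_comp, MonoidHom.comp_apply, hx', ← hξφ]
      congr 2
      exact Subtype.ext (L.π_incl (R := obj R) (Q := objSup hX hV R) le_sup_left r)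
    obtain ⟨x, hx, -⟩ := hL (L.incl (R := obj Q) (Q := objSup hX hV Q) le_sup_left)
      (L.comp x' (L.incl (R := obj R) (Q := objSup hX hV R) le_sup_left)) (by
        rintro _ ⟨r, rfl⟩
        refine ⟨φ r, Subtype.ext ?_⟩
        rw [key r]
        exact L.π_incl (R := obj Q) (Q := objSup hX hV Q) le_sup_left (φ r))
    refine ⟨⟨x, x', fun w hw => by rw [hx']; exact hξV w hw, hx.symm⟩, ?_⟩
    ext r
    rw [← L.π_extends hX hV hx.symm, hx', hξφ]
  π_τ {R Q} a := L.π_τ (R := obj R) (Q := obj Q) ⟨a, transporter_mono inf_le_left a.2⟩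

end Normalizer

end Locality

section Transporter

variable {N : Subgroup G} {L : Type v} [Group L]

/-- The `L`-transporter from `τ(T)` to `τ(R)`. -/
def groupTransporter (τ : N →* L) (T R : Subgroup G) : Set L :=
  {e | ∀ t : N, (t : G) ∈ T → ∃ r : N, (r : G) ∈ R ∧ e * τ t * e⁻¹ = τ r}

/-- Conjugation by `e ∈ L`, as a homomorphism `T → R`, where `T` and `R` are identified with their
images under the injective homomorphism `τ`. -/
noncomputable def groupConj {τ : N →* L} (hτ : Function.Injective τ) {T R : Subgroup G}
    (hT : T ≤ N) (e : groupTransporter τ T R) : T →* R :=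
  MonoidHom.mk' (fun t => ⟨(e.2 ⟨t, hT t.2⟩ t.2).choose, (e.2 ⟨t, hT t.2⟩ t.2).choose_spec.1⟩)
    (fun a b => by
      have h1 := (e.2 ⟨_, hT (a * b).2⟩ (a * b).2).choose_spec.2
      have h2 := (e.2 ⟨_, hT a.2⟩ a.2).choose_spec.2
      have h3 := (e.2 ⟨_, hT b.2⟩ b.2).choose_spec.2
      have h4 : τ ⟨_, hT (a * b).2⟩ = τ ⟨_, hT a.2⟩ * τ ⟨_, hT b.2⟩ :=
        map_mul τ ⟨_, hT a.2⟩ ⟨_, hT b.2⟩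
      have h5 := hτ (h1.symm.trans (Eq.trans (by rw [h4]; group)
        ((congrArg₂ (· * ·) h2 h3).trans (map_mul τ _ _).symm)))
      exact Subtype.ext (congrArg (fun n : N => (n : G)) h5))

theorem groupConj_spec {τ : N →* L} (hτ : Function.Injective τ) {T R : Subgroup G}
    (hT : T ≤ N) (hR : R ≤ N) (e : groupTransporter τ T R) (t : T) :
    (e : L) * τ ⟨t, hT t.2⟩ * (e : L)⁻¹ =
      τ ⟨groupConj hτ hT e t, hR (groupConj hτ hT e t).2⟩ :=
  (e.2 ⟨t, hT t.2⟩ t.2).choose_spec.2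

theorem groupConj_unique {τ : N →* L} (hτ : Function.Injective τ) {T R : Subgroup G}
    (hT : T ≤ N) (hR : R ≤ N) (e : groupTransporter τ T R) (φ : T →* R)
    (h : ∀ t : T, (e : L) * τ ⟨t, hT t.2⟩ * (e : L)⁻¹ = τ ⟨φ t, hR (φ t).2⟩) :
    groupConj hτ hT e = φ := by
  ext t
  have := hτ ((groupConj_spec hτ hT hR e t).symm.trans (h t))
  exact congrArg (fun n : N => (n : G)) this

end Transporter

/-- The transporter of a localizer `L` of `W`, as an `N_F(W)^Y`-locality over a set `Y` of subgroups
of `N_P(W)`: the morphisms `T → R` are the elements of the `L`-transporter from `τ(T)` to `τ(R)`,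
and the composition is the product in `L`. -/
noncomputable def transporterLocality {p : ℕ} {P : Subgroup G} {F : PCategory P} {W : Subgroup G}
    {hW : W ≤ P} {L : Type v} [Group L] {τ : ↥(normP P W) →* L} {π : L →* Monoid.End W}
    (h : IsLocalizer p F W hW L τ π) (Y : Set (Subgroup G)) (hY : ∀ T ∈ Y, T ≤ normP P W) :
    Locality.{u, v} (F.normalizer W hW) Y where
  Hom T R := groupTransporter τ (T : Subgroup G) R
  finite_hom T R := by
    have := h.finite
    infer_instance
  id Q := ⟨1, fun t ht => ⟨t, ht, by simp⟩⟩
  comp x y := ⟨x * y, fun t ht => by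
    obtain ⟨r, hr, hr'⟩ := y.2 t ht
    obtain ⟨s, hs, hs'⟩ := x.2 r hr
    exact ⟨s, hs, by rw [← hs', ← hr']; group⟩⟩
  id_comp x := Subtype.ext (one_mul _)
  comp_id x := Subtype.ext (mul_one _)
  assoc x y z := Subtype.ext (mul_assoc _ _ _)
  τ {R Q} a := ⟨τ ⟨a, a.2.1⟩, fun t ht => ⟨⟨a, a.2.1⟩ * t * ⟨a, a.2.1⟩⁻¹, a.2.2 t ht, by simp⟩⟩
  τ_one Q := Subtype.ext (map_one τ)
  τ_mul a b := Subtype.ext (map_mul τ ⟨a, a.2.1⟩ ⟨b, b.2.1⟩)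
  π {R Q} x := groupConj h.τ_injective (hY R R.2) x
  π_mem {R Q} x := (h.induces R Q (hY R R.2) (hY Q Q.2) _).2
    ⟨x, groupConj_spec h.τ_injective (hY R R.2) (hY Q Q.2) x⟩
  π_id Q := groupConj_unique _ _ (hY Q Q.2) _ _ (fun t => by simp)
  π_comp {T R Q} x y := groupConj_unique _ _ (hY Q Q.2) _ _ (fun t => by
    have h1 := groupConj_spec h.τ_injective (hY T T.2) (hY R R.2) y t
    have h2 := groupConj_spec h.τ_injective (hY R R.2) (hY Q Q.2) x
      (groupConj h.τ_injective (hY T T.2) y t)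
    rw [MonoidHom.comp_apply, ← h2, ← h1]
    group)
  π_full {R Q} φ hφ := by
    obtain ⟨e, he⟩ := (h.induces R Q (hY R R.2) (hY Q Q.2) φ).1 hφ
    exact ⟨⟨e, fun t ht => ⟨⟨φ ⟨t, ht⟩, hY Q Q.2 (φ ⟨t, ht⟩).2⟩, (φ ⟨t, ht⟩).2, he ⟨t, ht⟩⟩⟩,
      groupConj_unique _ _ (hY Q Q.2) _ _ he⟩
  π_τ {R Q} a := groupConj_unique _ _ (hY Q Q.2) _ _ (fun t => by
    have h1 : τ (⟨a, a.2.1⟩ * ⟨t, hY R R.2 t.2⟩ * ⟨a, a.2.1⟩⁻¹) =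
      τ ⟨a, a.2.1⟩ * τ ⟨t, hY R R.2 t.2⟩ * (τ ⟨a, a.2.1⟩)⁻¹ := by
        rw [map_mul, map_mul, map_inv]
    exact h1.symm)

/-- A perfect `F^X`-locality `L` is extendable: for every `F`-selfcentralizing subgroup `W` of `P`,
fully normalized in `F`, such that `N_P(W)` belongs to `X`, the normalizer of `W` in `L` is
isomorphic, as a locality, to the full subcategory over `X^W` of the transporter of the
`F`-localizer of `W`. -/
def Locality.IsExtendable {p : ℕ} {P : Subgroup G} {F : PCategory P} {X : Set (Subgroup G)}
    (L : Locality.{u, v} F X) (hX : F.IsUpClosed X) (hL : L.IsPerfect p) : Prop :=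
  ∀ (W : Subgroup G) (hW : F.IsSelfcentralizing W), F.IsFullyNormalized W → normP P W ∈ X →
    ∃ (E : Type v) (_ : Group E) (τ : ↥(normP P W) →* E) (π : E →* Monoid.End W)
      (h : IsLocalizer p F W hW.1 E τ π),
      Nonempty (Locality.Iso (L.normalizer hX hL.divisible W hW.1)
        (transporterLocality h (objNorm P X W) (fun _ hT => hT.2)))

end Puig

/-! Extendability at `V` identifies the normalizer of `V` in the locality with the transporter of
one finite group `E`, an `F`-localizer of `V`. Everything then becomes a statement about `E`, which
has `τ(N)` as a Sylow `p`-subgroup, where `N = N_P(V)`, and `N_F(V)` as the category of its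
conjugations on `N`.

Such a category is Frobenius (`IsModel.isFrobenius`): if `Q` is fully `K`-normalized, then
`N_N^K(Q)` is Sylow in `N_E^K(Q)`, and Sylow's theorem in `N_E^K(Q)` produces the required
extensions.

In the transporter of `E` the automorphism group of `Q` is `N_E(Q)`, and the normalizer of `W` is
the transporter of `N_E(W)`. So perfectness and extendability both ask that `N_E(W)` be a localizer
of a fully normalized, selfcentralizing `W`; by `IsModel.isLocalizer_groupNormK` this holds once
`C_E(W) ≤ W` (identifying `W` with `τ(W)`).

That inclusion is the heart of the proof (`IsModel.centralizer_le_image`). Here `V` is normal in `E`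
and `C_E(V) ≤ τ(N)`. A `p'`-element `k` of `C_E(W)` acts on the `p`-group `V·W`, and whatever
centralizes `C_{VW}(k) ≥ W` in `V·W` lies in `W`, so is fixed by `k`. A coprime action lemma makes
`k` centralize `V`; thus `k` lies in the `p`-group `τ(N)` and is trivial. Hence `C_E(W)` is a
`p`-group, a conjugate of `W·C_E(W)` lies in `τ(N)`, and selfcentralization in `N` concludes. -/

namespace Puig

/-! ### Coprime action on a `p`-group -/

/-- An element `k` of order prime to `p` that normalizes a `p`-subgroup `Q` and whose centralizer in
`Q` is selfcentralizing in `Q` centralizes `Q`. -/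
theorem commute_of_selfcentralizing_fixedPoints {p : ℕ} [Fact p.Prime] {E : Type v} [Group E]
    [Finite E] {Q : Subgroup E} (hQ : IsPGroup p Q) {k : E} (hkQ : ∀ q ∈ Q, k * q * k⁻¹ ∈ Q)
    (hk : (orderOf k).Coprime p)
    (hC : ∀ q ∈ Q, (∀ c ∈ Q, Commute k c → Commute q c) → Commute k q) :
    ∀ q ∈ Q, Commute k q := by
  set D : Subgroup Q := (Subgroup.centralizer {k}).subgroupOf Q with hD
  have mem_D : ∀ c : Q, c ∈ D ↔ Commute k c := fun c => by
    rw [hD, Subgroup.mem_subgroupOf, Subgroup.mem_centralizer_singleton_iff, eq_comm]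
    rfl
  suffices hDtop : D = ⊤ by
    intro q hq
    exact (mem_D ⟨q, hq⟩).1 (hDtop ▸ Subgroup.mem_top _)
  by_contra hne
  have := hQ.isNilpotent
  -- Normalizers grow in a nilpotent group: some `n` outside `D = C_Q(k)` normalizes `D`. The
  -- contradiction will be that `n` commutes with `k`.
  obtain ⟨n, hn, hnD⟩ := SetLike.exists_of_lt
    (Group.normalizerCondition_of_isNilpotent (G := Q) D (lt_top_iff_ne_top.2 hne))
  refine hnD ((mem_D n).2 ?_)
  set z : E := (n : E)⁻¹ * k * n * k⁻¹ with hz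
  have hzQ : z ∈ Q := by
    have := Q.mul_mem (Q.inv_mem n.2) (hkQ n n.2)
    simpa [hz, mul_assoc] using this
  -- Both `k` and `n⁻¹ k n` centralize `D`, hence so does `z`, and `hC` applies.
  have hkz : Commute k z := by
    refine hC z hzQ fun c hc hkc => ?_
    have h1 : Commute k (n * c * (n : E)⁻¹) :=
      (mem_D _).1 ((Subgroup.mem_normalizer_iff.1 hn ⟨c, hc⟩).1 ((mem_D _).2 hkc))
    have h2 : k * (n * c * (n : E)⁻¹) * k⁻¹ = n * c * (n : E)⁻¹ := by
      rw [h1.eq, mul_inv_cancel_right]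
    have h3 : k⁻¹ * c = c * k⁻¹ := (hkc.inv_left).eq
    calc z * c = (n : E)⁻¹ * k * n * (k⁻¹ * c) := by rw [hz]; group
      _ = (n : E)⁻¹ * (k * (n * c * (n : E)⁻¹) * k⁻¹) * k * n * k⁻¹ := by rw [h3]; group
      _ = c * z := by rw [h2, hz]; group
  have hconj : (n : E)⁻¹ * k * n = z * k := by rw [hz]; group
  -- The conjugate `n⁻¹ k n = z k` has the order of `k`, and `z` commutes with `k`; so the order of
  -- the `p`-element `z` divides that of `k`.
  have hz1 : z ^ orderOf k = 1 := by
    have h1 : ((n : E)⁻¹ * k * (n : E)⁻¹⁻¹) ^ orderOf k = 1 := by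
      rw [conj_pow, pow_orderOf_eq_one]; group
    rw [inv_inv, hconj, hkz.symm.mul_pow, pow_orderOf_eq_one, mul_one] at h1
    exact h1
  obtain ⟨j, hj⟩ := hQ ⟨z, hzQ⟩
  have hj' : z ^ p ^ j = 1 := congrArg Subtype.val hj
  have hz' : z = 1 := by
    rw [← orderOf_eq_one_iff]
    exact Nat.eq_one_of_dvd_coprimes (hk.pow_right j) (orderOf_dvd_of_pow_eq_one hz1)
      (orderOf_dvd_of_pow_eq_one hj')
  rw [hz', one_mul] at hconj
  have : (n : E) * k = k * n := by
    calc (n : E) * k = n * ((n : E)⁻¹ * k * n) := by rw [hconj]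
      _ = k * n := by group
  exact this.symm

/-! ### Finite groups inducing a category on a Sylow subgroup -/

section Model

variable {G : Type u} [Group G] {N : Subgroup G} {E : Type v} [Group E]

/-- The image under `τ` of the elements of `T`. -/
def image (τ : N →* E) (T : Subgroup G) : Subgroup E := (T.subgroupOf N).map τ

theorem mem_image {τ : N →* E} {T : Subgroup G} {e : E} :
    e ∈ image τ T ↔ ∃ n : N, (n : G) ∈ T ∧ τ n = e := by
  simp [image, Subgroup.mem_map, Subgroup.mem_subgroupOf]

theorem mem_image_of_mem {τ : N →* E} {T : Subgroup G} {n : N} (h : (n : G) ∈ T) :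
    τ n ∈ image τ T := mem_image.2 ⟨n, h, rfl⟩

theorem image_le_range (τ : N →* E) (T : Subgroup G) : image τ T ≤ τ.range := by
  intro e he
  obtain ⟨n, -, rfl⟩ := mem_image.1 he
  exact ⟨n, rfl⟩

theorem mem_groupTransporter_iff {τ : N →* E} {T R : Subgroup G} {e : E} :
    e ∈ groupTransporter τ T R ↔
      image τ T ≤ (image τ R).comap (MulAut.conj e).toMonoidHom := by
  constructor
  · intro h x hx
    obtain ⟨n, hn, rfl⟩ := mem_image.1 hx
    obtain ⟨r, hr, h⟩ := h n hn
    exact mem_image.2 ⟨r, hr, h.symm⟩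
  · intro h n hn
    obtain ⟨r, hr, h⟩ := mem_image.1 (h (mem_image_of_mem hn))
    exact ⟨r, hr, h.symm⟩

theorem image_sup {τ : N →* E} {T W : Subgroup G} (hT : T ≤ N) (hW : W ≤ N) :
    image τ (T ⊔ W) = image τ T ⊔ image τ W := by
  rw [image, Subgroup.subgroupOf_sup hT hW, Subgroup.map_sup]
  rfl

/-- The preimage of a subgroup under conjugation is a subgroup, so both factors can be checked
separately. This supplies the extensions `T · W → R · W` that normalizers require. -/
theorem groupTransporter_sup {τ : N →* E} {T W R W' : Subgroup G} (hT : T ≤ N) (hW : W ≤ N)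
    {e : E} (h : e ∈ groupTransporter τ T R) (h' : e ∈ groupTransporter τ W W') :
    e ∈ groupTransporter τ (T ⊔ W) (R ⊔ W') := by
  intro n hn
  have key : image τ T ⊔ image τ W ≤ (image τ (R ⊔ W')).comap (MulAut.conj e).toMonoidHom := by
    refine sup_le (fun x hx => ?_) (fun x hx => ?_)
    · obtain ⟨r, hr, h⟩ := mem_image.1 (mem_groupTransporter_iff.1 h hx)
      exact mem_image.2 ⟨r, (le_sup_left : R ≤ R ⊔ W') hr, h⟩
    · obtain ⟨r, hr, h⟩ := mem_image.1 (mem_groupTransporter_iff.1 h' hx)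
      exact mem_image.2 ⟨r, (le_sup_right : W' ≤ R ⊔ W') hr, h⟩
  rw [← image_sup hT hW, ← mem_groupTransporter_iff] at key
  exact key n hn

/-- The elements of `E` that normalize `τ(Q)` and act on it as an element of `K ≤ Aut(Q)`. -/
def groupNormK (τ : N →* E) {Q : Subgroup G} (hQ : Q ≤ N) (K : Subgroup (MulAut Q)) :
    Subgroup E where
  carrier := {e | ∃ χ ∈ K, ∀ q : Q, e * τ ⟨q, hQ q.2⟩ * e⁻¹ = τ ⟨χ q, hQ (χ q).2⟩}
  one_mem' := ⟨1, K.one_mem, fun q => by simp⟩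
  mul_mem' := by
    rintro a b ⟨χ, hχ, h⟩ ⟨χ', hχ', h'⟩
    refine ⟨χ * χ', K.mul_mem hχ hχ', fun q => ?_⟩
    have := h (χ' q)
    rw [← h' q] at this
    rw [MulAut.mul_apply, ← this]
    group
  inv_mem' := by
    rintro a ⟨χ, hχ, h⟩
    refine ⟨χ⁻¹, K.inv_mem hχ, fun q => ?_⟩
    have := h (χ⁻¹ q)
    rw [MulAut.apply_inv_self] at this
    rw [← this]
    group

/-- Membership in `N_N^K(Q)` is detected by `τ`. -/
theorem map_mem_groupNormK_iff {τ : N →* E} (hτ : Function.Injective τ) {Q : Subgroup G}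
    {hQ : Q ≤ N} {K : Subgroup (MulAut Q)} {y : N} :
    τ y ∈ groupNormK τ hQ K ↔ (y : G) ∈ PCategory.normK N Q K := by
  have key : ∀ (χ : MulAut Q) (q : Q), τ y * τ ⟨q, hQ q.2⟩ * (τ y)⁻¹ = τ ⟨χ q, hQ (χ q).2⟩ ↔
      (y : G) * q * (y : G)⁻¹ = χ q := by
    intro χ q
    rw [← map_inv, ← map_mul, ← map_mul, hτ.eq_iff, Subtype.ext_iff]
    rfl
  constructor
  · rintro ⟨χ, hχ, h⟩
    exact ⟨y.2, χ, hχ, fun q => (key χ q).1 (h q)⟩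
  · rintro ⟨-, χ, hχ, h⟩
    exact ⟨χ, hχ, fun q => (key χ q).2 (h q)⟩

theorem normK_top (P Q : Subgroup G) : PCategory.normK P Q ⊤ = normP P Q := by
  ext y
  constructor
  · rintro ⟨hy, χ, -, h⟩
    refine ⟨hy, Subgroup.mem_normalizer_iff.2 fun g => ⟨fun hg => ?_, fun hg => ?_⟩⟩
    · exact (h ⟨g, hg⟩) ▸ (χ _).2
    · have h1 := h (χ⁻¹ ⟨_, hg⟩)
      rw [MulAut.apply_inv_self] at h1
      have h2 : ((χ⁻¹ ⟨_, hg⟩ : Q) : G) = g := mul_left_cancel (mul_right_cancel h1)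
      exact h2 ▸ (χ⁻¹ ⟨_, hg⟩ : Q).2
  · rintro ⟨hy, hyn⟩
    have hyn' := Subgroup.mem_normalizer_iff.1 hyn
    refine ⟨hy, { toFun := fun q => ⟨y * q * y⁻¹, (hyn' q).1 q.2⟩
                  invFun := fun q => ⟨y⁻¹ * q * y, (hyn' _).2 (by
                    convert q.2 using 1
                    group)⟩
                  left_inv := fun q => Subtype.ext (by group)
                  right_inv := fun q => Subtype.ext (by group)
                  map_mul' := fun a b => Subtype.ext (by simp [mul_assoc]) },
      Subgroup.mem_top _, fun q => rfl⟩

variable {p : ℕ} {C : PCategory N}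

/-- The finite group `E`, with `τ(N)` as a Sylow `p`-subgroup, induces the `N`-category `C`. -/
structure IsModel (p : ℕ) (C : PCategory N) (τ : N →* E) : Prop where
  finite : Finite E
  injective : Function.Injective τ
  sylow : ∃ S : Sylow p E, (S : Subgroup E) = τ.range
  induces : ∀ (T R : Subgroup G) (hT : T ≤ N) (hR : R ≤ N) (φ : T →* R),
    φ ∈ C.Hom T R ↔ ∃ e : E, ∀ t : T, e * τ ⟨t, hT t.2⟩ * e⁻¹ = τ ⟨φ t, hR (φ t).2⟩

/-- The localizer of `W` is a model of the normalizer of `W`. -/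
theorem IsLocalizer.isModel {P : Subgroup G} {F : PCategory P} {W : Subgroup G} {hW : W ≤ P}
    {τ : ↥(normP P W) →* E} {π : E →* Monoid.End W} (h : IsLocalizer p F W hW E τ π) :
    IsModel p (F.normalizer W hW) τ :=
  ⟨h.finite, h.τ_injective, h.sylow, h.induces⟩

namespace IsModel

variable {τ : N →* E}

theorem finite_base (h : IsModel p C τ) : Finite N :=
  have := h.finite
  Finite.of_injective τ h.injective

theorem isPGroup_range (h : IsModel p C τ) : IsPGroup p τ.range := by
  obtain ⟨S, hS⟩ := h.sylow
  exact hS ▸ S.2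

theorem isPGroup_image (h : IsModel p C τ) (T : Subgroup G) : IsPGroup p (image τ T) :=
  h.isPGroup_range.to_le (image_le_range τ T)

theorem groupConj_mem (h : IsModel p C τ) {T R : Subgroup G} (hT : T ≤ N) (hR : R ≤ N)
    (e : groupTransporter τ T R) : groupConj h.injective hT e ∈ C.Hom T R :=
  (h.induces T R hT hR _).2 ⟨e, groupConj_spec h.injective hT hR e⟩

/-- Sylow's theorem. Conjugation by such a `g` yields morphisms of `C` into `N`, to which full
normalization and selfcentralization can be applied. -/
theorem exists_conj_mem_range [Fact p.Prime] (h : IsModel p C τ) {H : Subgroup E}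
    (hH : IsPGroup p H) : ∃ g : E, ∀ x ∈ H, g * x * g⁻¹ ∈ τ.range := by
  have := h.finite
  obtain ⟨S, hS⟩ := h.sylow
  obtain ⟨T, hT⟩ := hH.exists_le_sylow
  obtain ⟨g, hg⟩ := MulAction.exists_smul_eq E T S
  refine ⟨g, fun x hx => ?_⟩
  rw [← hS, ← hg, Sylow.coe_subgroup_smul]
  exact Subgroup.smul_mem_pointwise_smul _ (MulAut.conj g) _ (hT hx)

/-- If `Q` is fully `K`-normalized then `N_N^K(Q)` is a Sylow `p`-subgroup of `N_E^K(Q)`. -/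
theorem exists_sylow_groupNormK [Fact p.Prime] (h : IsModel p C τ) {Q : Subgroup G} (hQ : Q ≤ N)
    {K : Subgroup (MulAut Q)} (hK : C.IsFullyKNormalized Q K) :
    ∃ T : Sylow p (groupNormK τ hQ K), ∀ e : groupNormK τ hQ K,
      e ∈ T ↔ ∃ y : N, (y : G) ∈ PCategory.normK N Q K ∧ τ y = e := by
  have := h.finite
  set M := PCategory.normK N Q K with hM
  have hMN : M ≤ N := fun y hy => hy.1
  have hA : IsPGroup p ((image τ M).subgroupOf (groupNormK τ hQ K)) :=
    (h.isPGroup_image M).comap_of_injective _ (Subgroup.subtype_injective _)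
  obtain ⟨T, hT⟩ := hA.exists_le_sylow
  refine ⟨T, fun e => ⟨fun he => ?_, ?_⟩⟩
  swap
  · rintro ⟨y, hy, hye⟩
    exact hT (Subgroup.mem_subgroupOf.2 (mem_image.2 ⟨y, hy, hye⟩))
  -- It remains to see that `T` is no larger than `τ(M)`. Since `T'` normalizes `τ(Q)`, the product
  -- `τ(Q) T'` is a `p`-group, and some `g` conjugates it into `τ(N)`; on `Q · M` this conjugation
  -- is a morphism `ψ` of `C`.
  set T' : Subgroup E := (T : Subgroup (groupNormK τ hQ K)).map (Subgroup.subtype _) with hT'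
  have hnorm : T' ≤ Subgroup.normalizer (image τ Q : Set E) := by
    rintro _ ⟨x, -, rfl⟩
    obtain ⟨χ, -, hχ⟩ := x.2
    refine Subgroup.mem_normalizer_iff.2 fun g => ⟨fun hg => ?_, fun hg => ?_⟩
    · obtain ⟨n, hn, rfl⟩ := mem_image.1 hg
      exact mem_image.2 ⟨_, (χ ⟨n, hn⟩).2, (hχ ⟨n, hn⟩).symm⟩
    · obtain ⟨n, hn, hn'⟩ := mem_image.1 hg
      have h1 := hχ (χ⁻¹ ⟨n, hn⟩)
      simp only [MulAut.apply_inv_self] at h1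
      have h2 : τ ⟨(χ⁻¹ ⟨n, hn⟩ : Q), hQ (χ⁻¹ ⟨n, hn⟩ : Q).2⟩ = g :=
        mul_left_cancel (mul_right_cancel (h1.trans hn'))
      exact mem_image.2 ⟨_, (χ⁻¹ ⟨n, hn⟩ : Q).2, h2⟩
  have hp : IsPGroup p (image τ Q ⊔ T' : Subgroup E) :=
    (h.isPGroup_image Q).to_sup_of_normal_left' (T.2.map _) hnorm
  obtain ⟨g, hg⟩ := h.exists_conj_mem_range hp
  have hQM : Q ⊔ M ≤ N := sup_le hQ hMN
  have hgt : g ∈ groupTransporter τ (Q ⊔ M) N := by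
    intro n hn
    have h1 : τ n ∈ image τ Q ⊔ T' := by
      have h2 : τ n ∈ image τ (Q ⊔ M) := mem_image_of_mem hn
      rw [image_sup hQ hMN] at h2
      refine (sup_le_sup_left (fun x hx => ?_) _ : image τ Q ⊔ image τ M ≤ image τ Q ⊔ T') h2
      obtain ⟨y, hy, rfl⟩ := mem_image.1 hx
      exact ⟨⟨τ y, (map_mem_groupNormK_iff h.injective).2 hy⟩,
        hT (Subgroup.mem_subgroupOf.2 hx), rfl⟩
    obtain ⟨r, hr⟩ := hg _ h1
    exact ⟨r, r.2, hr.symm⟩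
  have spec := groupConj_spec h.injective hQM le_rfl ⟨g, hgt⟩
  have hmem := h.groupConj_mem hQM le_rfl ⟨g, hgt⟩
  -- The conjugate `y` of `e` acts on `ψ(Q)` through the transport of `K`, so full `K`-normalization
  -- puts it in `ψ(M)`. Undoing the conjugation puts `e` in `τ(M)`.
  obtain ⟨y, hy⟩ := hg e ((le_sup_right : T' ≤ _) ⟨e, he, rfl⟩)
  obtain ⟨χ, hχK, hχ⟩ := e.2
  obtain ⟨w, hw, hwy⟩ := (hK.2 _ hmem y).2 ⟨χ, hχK, fun q => by
    have h1 := spec ⟨q, (le_sup_left : Q ≤ Q ⊔ M) q.2⟩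
    have h2 := spec ⟨χ q, (le_sup_left : Q ≤ Q ⊔ M) (χ q).2⟩
    have h3 := hχ q
    refine h.injective ?_
    rw [map_mul, map_mul, map_inv]
    refine Eq.trans ?_ h2
    refine (congrArg (fun z => τ y * z * (τ y)⁻¹) h1.symm).trans ?_
    rw [hy, ← h3]
    group⟩
  have h1 := spec w
  rw [hwy, hy] at h1
  exact ⟨_, hw, mul_left_cancel (mul_right_cancel h1)⟩

/-- A subgroup of `N` is selfcentralizing in `E` if it is `C`-selfcentralizing and `N` has a
subgroup normal in `E` whose centralizer is contained in `N`. -/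
theorem centralizer_le_image [Fact p.Prime] (h : IsModel p C τ) {V : Subgroup G} (hV : V ≤ N)
    (hVn : ∀ e : E, e ∈ groupTransporter τ V V)
    (hVc : ∀ e : E, (∀ n : N, (n : G) ∈ V → Commute e (τ n)) → e ∈ τ.range)
    {W : Subgroup G} (hW : C.IsSelfcentralizing W) {e : E}
    (he : ∀ n : N, (n : G) ∈ W → Commute e (τ n)) : ∃ n : N, (n : G) ∈ W ∧ τ n = e := by
  have := h.finite
  set Z : Subgroup E := Subgroup.centralizer (image τ W : Set E) with hZ
  have mem_Z : ∀ x, x ∈ Z ↔ ∀ n : N, (n : G) ∈ W → Commute x (τ n) := by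
    intro x
    rw [hZ, Subgroup.mem_centralizer_iff]
    constructor
    · intro hx n hn
      exact (hx _ (mem_image_of_mem hn)).symm
    · rintro hx _ hy
      obtain ⟨n, hn, rfl⟩ := mem_image.1 hy
      exact (hx n hn).symm
  have coprime : ∀ k ∈ Z, (orderOf k).Coprime p → k = 1 := by
    intro k hkZ hk
    have hkW : k ∈ groupTransporter τ W W := fun n hn => ⟨n, hn, by
      rw [((mem_Z k).1 hkZ n hn).eq, mul_inv_cancel_right]⟩
    have hkVW := groupTransporter_sup hV hW.1 (hVn k) hkW
    have hcomm := commute_of_selfcentralizing_fixedPoints (h.isPGroup_image (V ⊔ W)) (k := k)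
      (fun q hq => mem_groupTransporter_iff.1 hkVW hq) hk (by
        -- The fixed points of `k` include `W`, so `q` centralizes `W`. Selfcentralization, applied
        -- to the inclusion `W ≤ N`, gives `q ∈ W`, which `k` centralizes.
        intro q hq hqc
        obtain ⟨n, hn, rfl⟩ := mem_image.1 hq
        have hincl := C.conj_mem hW.1 le_rfl ⟨1, one_mem_transporter hW.1⟩
        obtain ⟨w, hw⟩ := hW.2 _ hincl n (fun w => by
          refine h.injective ?_
          have h1 : conjHom (P := N) ⟨1, one_mem_transporter hW.1⟩ w = (⟨w, hW.1 w.2⟩ : N) :=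
            Subtype.ext (by simp [conjHom])
          rw [h1, map_mul, map_mul]
          exact hqc _ (mem_image_of_mem ((le_sup_right : W ≤ V ⊔ W) w.2))
            ((mem_Z k).1 hkZ ⟨w, hW.1 w.2⟩ w.2))
        have hnW : (n : G) ∈ W := by
          rw [← hw]
          simp [conjHom]
        exact (mem_Z k).1 hkZ n hnW)
    -- Now `k` centralizes `V`, so it lies in the `p`-group `τ(N)` while having order prime to `p`.
    obtain ⟨j, hj⟩ := h.isPGroup_range ⟨k, hVc k fun n hn =>
      hcomm _ (mem_image_of_mem ((le_sup_left : V ≤ V ⊔ W) hn))⟩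
    have hj' : k ^ p ^ j = 1 := congrArg Subtype.val hj
    rw [← orderOf_eq_one_iff]
    exact Nat.eq_one_of_dvd_coprimes (hk.pow_right j) dvd_rfl (orderOf_dvd_of_pow_eq_one hj')
  have hZp : IsPGroup p Z := by
    intro g
    obtain ⟨a, m, hm, ham⟩ := Nat.exists_eq_pow_mul_and_not_dvd (orderOf_pos (g : E)).ne' p
      (Fact.out : p.Prime).ne_one
    -- Raising `g` to the `p`-part of its order leaves an element of order prime to `p`, which is
    -- trivial.
    refine ⟨a, Subtype.ext (coprime _ (Z.pow_mem g.2 _) ?_)⟩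
    have : orderOf ((g : E) ^ p ^ a) = m := by
      rw [orderOf_pow_of_dvd (pow_ne_zero _ (Fact.out : p.Prime).ne_zero) (ham ▸ dvd_mul_right _ _),
        ham, Nat.mul_div_cancel_left _ (pow_pos (Fact.out : p.Prime).pos _)]
    change Nat.Coprime (orderOf ((g : E) ^ p ^ a)) p
    rw [this]
    exact ((Nat.Prime.coprime_iff_not_dvd Fact.out).2 hm).symm
  -- Conjugate `W · C_E(W)` into `τ(N)`: the image `y` of `e` centralizes the image of `W`, hence
  -- belongs to it.
  obtain ⟨g, hg⟩ := h.exists_conj_mem_range ((h.isPGroup_image W).to_sup_of_normal_left' hZp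
    (Subgroup.centralizer_le_normalizer _))
  have hgt : g ∈ groupTransporter τ W N := by
    intro n hn
    obtain ⟨r, hr⟩ := hg _ ((le_sup_left : image τ W ≤ _) (mem_image_of_mem hn))
    exact ⟨r, r.2, hr.symm⟩
  have spec := groupConj_spec h.injective hW.1 le_rfl ⟨g, hgt⟩
  obtain ⟨y, hy⟩ := hg e ((le_sup_right : Z ≤ _) ((mem_Z e).2 he))
  obtain ⟨w, hw⟩ := hW.2 _ (h.groupConj_mem hW.1 le_rfl ⟨g, hgt⟩) y (fun q => by
    have h1 := spec q
    have h2 := (he ⟨q, hW.1 q.2⟩ q.2).eq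
    refine h.injective ?_
    rw [map_mul, map_mul]
    refine (congrArg (fun z => τ y * z) h1.symm).trans
      (Eq.trans ?_ (congrArg (fun z => z * τ y) h1))
    rw [hy]
    calc _ = g * (e * τ ⟨q, hW.1 q.2⟩) * g⁻¹ := by group
      _ = _ := by rw [h2]; group)
  have h1 := spec w
  rw [hw, hy] at h1
  exact ⟨_, w.2, mul_left_cancel (mul_right_cancel h1)⟩

end IsModel

end Model


/-! ### Conjugation on a Sylow subgroup gives a Frobenius category -/

section Frobenius

variable {G : Type u} [Group G] {N : Subgroup G} {E : Type v} [Group E] {p : ℕ} {C : PCategory N}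
  {τ : N →* E}

/-- The action of `N_E(Q)` on `Q`. -/
noncomputable def groupNormAut (hτ : Function.Injective τ) {Q : Subgroup G} (hQ : Q ≤ N) :
    groupNormK τ hQ ⊤ →* MulAut Q :=
  -- The chosen automorphism is determined by `e`, because `τ` is injective; hence the choice is
  -- multiplicative.
  MonoidHom.mk' (fun e => e.2.choose) (fun a b => by
    have ha := a.2.choose_spec.2
    have hb := b.2.choose_spec.2
    have hab := (a * b).2.choose_spec.2
    ext q
    rw [MulAut.mul_apply]
    have h1 := ha (b.2.choose q)
    have h2 := hab q
    rw [← hb q] at h1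
    refine congrArg (fun n : N => (n : G)) (hτ (h2.symm.trans (Eq.trans ?_ h1)))
    rw [Subgroup.coe_mul]
    group)

theorem groupNormAut_spec (hτ : Function.Injective τ) {Q : Subgroup G} (hQ : Q ≤ N)
    (e : groupNormK τ hQ ⊤) (q : Q) : (e : E) * τ ⟨q, hQ q.2⟩ * (e : E)⁻¹ =
      τ ⟨groupNormAut hτ hQ e q, hQ (groupNormAut hτ hQ e q).2⟩ :=
  e.2.choose_spec.2 q

theorem groupNormAut_apply_eq (hτ : Function.Injective τ) {Q : Subgroup G} (hQ : Q ≤ N)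
    (e : groupNormK τ hQ ⊤) (q r : Q)
    (h : (e : E) * τ ⟨q, hQ q.2⟩ * (e : E)⁻¹ = τ ⟨r, hQ r.2⟩) : groupNormAut hτ hQ e q = r :=
  Subtype.ext (congrArg (fun n : N => (n : G))
    (hτ ((groupNormAut_spec hτ hQ e q).symm.trans h)))

/-- Conjugation is injective and `Q` is finite, so mapping `Q` into itself already gives an
automorphism. -/
theorem mem_groupNormK_top_iff [Finite N] (hτ : Function.Injective τ) {Q : Subgroup G}
    (hQ : Q ≤ N) {e : E} : e ∈ groupNormK τ hQ ⊤ ↔ e ∈ groupTransporter τ Q Q := by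
  constructor
  · rintro ⟨χ, -, hχ⟩ n hn
    exact ⟨_, (χ ⟨n, hn⟩).2, hχ ⟨n, hn⟩⟩
  · intro he
    have : Finite Q := Finite.of_injective _ (Subgroup.inclusion_injective hQ)
    have spec := groupConj_spec hτ hQ hQ ⟨e, he⟩
    have hinj : Function.Injective (groupConj hτ hQ ⟨e, he⟩) := by
      intro a b hab
      have h1 := spec a
      rw [hab, ← spec b] at h1
      exact Subtype.ext (congrArg (fun n : N => (n : G))
        (hτ (mul_left_cancel (mul_right_cancel h1))))
    exact ⟨MulEquiv.ofBijective _ (Finite.injective_iff_bijective.1 hinj), Subgroup.mem_top _, spec⟩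

namespace IsModel

/-- If `e` induces `φ` and `f` induces `φ ∘ ψ`, then `e⁻¹ f` induces `ψ`. -/
theorem isDivisible (h : IsModel p C τ) : C.IsDivisible := by
  intro T R Q φ ψ hφ hφψ
  have hT := C.le_dom hφψ
  have hR := C.le_dom hφ
  have hQ := C.le_cod hφ
  obtain ⟨e, he⟩ := (h.induces R Q hR hQ φ).1 hφ
  obtain ⟨f, hf⟩ := (h.induces T Q hT hQ _).1 hφψ
  refine (h.induces T R hT hR ψ).2 ⟨e⁻¹ * f, fun t => ?_⟩
  have h1 := (hf t).trans (he (ψ t)).symm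
  calc _ = e⁻¹ * (f * τ ⟨t, hT t.2⟩ * f⁻¹) * e := by group
    _ = _ := by rw [h1]; group

/-- `C(N)` is a quotient of `N_E(N)`, a surjection of finite groups maps Sylow subgroups onto Sylow
subgroups, and `τ(N)` acts on `N` by the inner automorphisms. -/
theorem exists_sylow_autTop [Fact p.Prime] (h : IsModel p C τ) :
    ∃ S : Sylow p C.autTop,
      (S : Subgroup C.autTop).map C.autTop.subtype = (MulAut.conj : N →* MulAut N).range := by
  have := h.finite
  obtain ⟨S, hS⟩ := h.sylow
  set f := groupNormAut h.injective (le_refl N) with hf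
  have hfmem : ∀ e, f e ∈ C.autTop := fun e =>
    ⟨(h.induces N N le_rfl le_rfl _).2 ⟨e, groupNormAut_spec h.injective le_rfl e⟩,
      (h.induces N N le_rfl le_rfl _).2 ⟨(e⁻¹ : groupNormK τ (le_refl N) ⊤), fun q => by
        have h1 := groupNormAut_spec h.injective le_rfl e⁻¹ q
        rw [map_inv] at h1
        exact h1⟩⟩
  have hsurj : Function.Surjective (f.codRestrict C.autTop hfmem) := by
    intro α
    obtain ⟨e, he⟩ := (h.induces N N le_rfl le_rfl _).1 α.2.1
    refine ⟨⟨e, α, Subgroup.mem_top _, he⟩, Subtype.ext (MulEquiv.ext fun q => ?_)⟩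
    exact groupNormAut_apply_eq h.injective le_rfl _ q _ (he q)
  have hconj : ∀ y q : N, τ y * τ q * (τ y)⁻¹ = τ (MulAut.conj y q) := fun y q => by simp
  have hSle : (S : Subgroup E) ≤ groupNormK τ (le_refl N) ⊤ := by
    rw [hS]
    rintro _ ⟨y, rfl⟩
    exact ⟨MulAut.conj y, Subgroup.mem_top _, hconj y⟩
  have hfτ : ∀ (y : N) (hy : τ y ∈ groupNormK τ (le_refl N) ⊤), f ⟨τ y, hy⟩ = MulAut.conj y :=
    fun y hy => MulEquiv.ext fun q => groupNormAut_apply_eq h.injective le_rfl _ q _ (hconj y q)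
  refine ⟨(S.subtype hSle).mapSurjective hsurj, ?_⟩
  rw [Sylow.coe_mapSurjective, Sylow.coe_subtype]
  ext α
  constructor
  · rintro ⟨_, ⟨e, he, rfl⟩, rfl⟩
    have he' : (e : E) ∈ τ.range := hS ▸ he
    obtain ⟨y, hy⟩ := he'
    have hye : e = ⟨τ y, hy ▸ e.2⟩ := Subtype.ext hy.symm
    refine ⟨y, ?_⟩
    rw [hye]
    exact (hfτ y _).symm
  · rintro ⟨y, rfl⟩
    have hyS : τ y ∈ (S : Subgroup E) := hS ▸ ⟨y, rfl⟩
    exact ⟨_, ⟨⟨τ y, hSle hyS⟩, hyS, rfl⟩, hfτ y _⟩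

/-- If `e` induces `φ`, it conjugates `N_N^K(Q)` to a `p`-subgroup of `N_E^{K'}(Q')`. As
`N_N^{K'}(Q')` is Sylow there, some `n` in `N_E^{K'}(Q')` moves that subgroup into `τ(N)`, and
conjugation by `n e` is the extension. -/
theorem exists_extension [Fact p.Prime] (h : IsModel p C τ) (Q Q' : Subgroup G) (φ : Q ≃* Q')
    (K : Subgroup (MulAut Q)) (hφ : φ.toMonoidHom ∈ C.Hom Q Q')
    (hQ' : C.IsFullyKNormalized Q' (K.map (MulAut.congr φ).toMonoidHom)) :
    ∃ ψ ∈ C.Hom (Q ⊔ PCategory.normK N Q K) N, ∃ χ ∈ K, ∀ q : Q,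
      (ψ ⟨q, (le_sup_left : Q ≤ Q ⊔ PCategory.normK N Q K) q.2⟩ : G) = φ (χ q) := by
  have := h.finite
  have hQN := C.le_dom hφ
  set M := PCategory.normK N Q K with hM
  set K' := K.map (MulAut.congr φ).toMonoidHom with hK'
  have hMN : M ≤ N := fun y hy => hy.1
  have hQM : Q ⊔ M ≤ N := sup_le hQN hMN
  obtain ⟨e, he⟩ := (h.induces Q Q' hQN hQ'.1 _).1 hφ
  obtain ⟨T, hT⟩ := h.exists_sylow_groupNormK hQ'.1 hQ'
  have hle : (image τ M).map (MulAut.conj e).toMonoidHom ≤ groupNormK τ hQ'.1 K' := by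
    rintro _ ⟨x, hx, rfl⟩
    obtain ⟨y, hy, rfl⟩ := mem_image.1 hx
    obtain ⟨χ, hχ, hχy⟩ := (map_mem_groupNormK_iff (hQ := hQN) h.injective).2 hy
    refine ⟨_, Subgroup.mem_map_of_mem _ hχ, fun q => ?_⟩
    have h1 := he (φ.symm q)
    have h2 := he (χ (φ.symm q))
    have h3 := hχy (φ.symm q)
    simp only [MulEquiv.toMonoidHom_eq_coe, MonoidHom.coe_coe, MulEquiv.apply_symm_apply] at h1 h2
    refine Eq.trans ?_ h2
    rw [← h1, ← h3]
    simp only [MulEquiv.toMonoidHom_eq_coe, MonoidHom.coe_coe, MulAut.conj_apply]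
    group
  have hp : IsPGroup p (((image τ M).map (MulAut.conj e).toMonoidHom).subgroupOf
      (groupNormK τ hQ'.1 K')) :=
    ((h.isPGroup_image M).map _).comap_of_injective _ (Subgroup.subtype_injective _)
  obtain ⟨S, hS⟩ := hp.exists_le_sylow
  obtain ⟨n, hn⟩ := MulAction.exists_smul_eq (groupNormK τ hQ'.1 K') S T
  have hnM : ∀ y : N, (y : G) ∈ M →
      ∃ r : N, (n : E) * e * τ y * ((n : E) * e)⁻¹ = τ r := by
    intro y hy
    have h1 : (MulAut.conj e) (τ y) ∈ (image τ M).map (MulAut.conj e).toMonoidHom :=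
      ⟨τ y, mem_image_of_mem hy, rfl⟩
    have h2 : n * ⟨_, hle h1⟩ * n⁻¹ ∈ T := by
      rw [← hn]
      exact Subgroup.smul_mem_pointwise_smul _ (MulAut.conj n) _ (hS (Subgroup.mem_subgroupOf.2 h1))
    obtain ⟨r, -, hr⟩ := (hT _).1 h2
    refine ⟨r, ?_⟩
    rw [hr]
    simp only [Subgroup.coe_mul, Subgroup.coe_inv, MulAut.conj_apply]
    group
  -- The correction `n` acts on `Q'` as `φ χ φ⁻¹` with `χ ∈ K`, so `n e` acts on `Q` as `φ ∘ χ`.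
  obtain ⟨χ', hχ', hn'⟩ := n.2
  obtain ⟨χ, hχ, rfl⟩ := hχ'
  have hnQ : ∀ q : Q, (n : E) * e * τ ⟨q, hQN q.2⟩ * ((n : E) * e)⁻¹ =
      τ ⟨φ (χ q), hQ'.1 (φ (χ q)).2⟩ := by
    intro q
    have h1 := hn' (φ q)
    have h2 := he q
    simp only [MulEquiv.toMonoidHom_eq_coe, MonoidHom.coe_coe] at h1 h2
    have h3 : (MulAut.congr φ) χ (φ q) = φ (χ q) := by simp [MulAut.congr]
    simp only [h3] at h1
    rw [← h1, ← h2]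
    group
  have hmem : (n : E) * e ∈ groupTransporter τ (Q ⊔ M) N := by
    have h1 := groupTransporter_sup (R := N) (W' := N) hQN hMN (e := (n : E) * e)
      (fun y hy => ⟨_, hQ'.1 (φ (χ ⟨y, hy⟩)).2, hnQ ⟨y, hy⟩⟩)
      (fun y hy => by
        obtain ⟨r, hr⟩ := hnM y hy
        exact ⟨r, r.2, hr⟩)
    rwa [sup_idem] at h1
  refine ⟨_, h.groupConj_mem hQM le_rfl ⟨_, hmem⟩, χ, hχ, fun q => ?_⟩
  have h1 := groupConj_spec h.injective hQM le_rfl ⟨_, hmem⟩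
    ⟨q, (le_sup_left : Q ≤ Q ⊔ M) q.2⟩
  exact congrArg (fun n : N => (n : G)) (h.injective (h1.symm.trans (hnQ q)))

/-- The category induced by a finite group on a Sylow `p`-subgroup is a Frobenius category. -/
theorem isFrobenius [Fact p.Prime] (h : IsModel p C τ) : C.IsFrobenius p :=
  ⟨h.isDivisible, h.exists_sylow_autTop, h.exists_extension⟩

end IsModel

end Frobenius

/-! ### Normalizers in a model as localizers -/

section Localizer

variable {G : Type u} [Group G] {N : Subgroup G} {E : Type v} [Group E] {p : ℕ} {C : PCategory N}
  {τ : N →* E}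

/-- The restriction of `τ` to a homomorphism `N_N(W) → N_E(W)`. -/
def groupNormHom (hτ : Function.Injective τ) {W : Subgroup G} (hW : W ≤ N) :
    ↥(normP N W) →* groupNormK τ hW ⊤ :=
  (τ.comp (Subgroup.inclusion (inf_le_left : normP N W ≤ N))).codRestrict _ (fun y =>
    (map_mem_groupNormK_iff hτ).2 (by rw [normK_top]; exact y.2))

theorem coe_groupNormHom (hτ : Function.Injective τ) {W : Subgroup G} (hW : W ≤ N)
    (y : ↥(normP N W)) : (groupNormHom hτ hW y : E) = τ ⟨y, y.2.1⟩ := rfl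

theorem groupNormHom_injective (hτ : Function.Injective τ) {W : Subgroup G} (hW : W ≤ N) :
    Function.Injective (groupNormHom hτ hW) := by
  intro a b hab
  have h1 : τ ⟨a, a.2.1⟩ = τ ⟨b, b.2.1⟩ := congrArg Subtype.val hab
  exact Subtype.ext (congrArg (fun n : N => (n : G)) (hτ h1))

/-- The action of `N_E(W)` on `W`, by endomorphisms. -/
noncomputable def groupNormEnd (hτ : Function.Injective τ) {W : Subgroup G} (hW : W ≤ N) :
    groupNormK τ hW ⊤ →* Monoid.End W where
  toFun e := (groupNormAut hτ hW e).toMonoidHom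
  map_one' := by rw [map_one]; rfl
  map_mul' a b := by rw [map_mul]; rfl

theorem mem_groupTransporter_groupNormHom_iff (hτ : Function.Injective τ) {W : Subgroup G}
    (hW : W ≤ N) {T R : Subgroup G} (hT : T ≤ normP N W) (hR : R ≤ normP N W)
    (e : groupNormK τ hW ⊤) :
    e ∈ groupTransporter (groupNormHom hτ hW) T R ↔ (e : E) ∈ groupTransporter τ T R := by
  constructor
  · intro h n hn
    obtain ⟨r, hr, h1⟩ := h ⟨n, hT hn⟩ hn
    exact ⟨⟨r, r.2.1⟩, hr, congrArg Subtype.val h1⟩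
  · intro h n hn
    obtain ⟨r, hr, h1⟩ := h ⟨n, n.2.1⟩ hn
    exact ⟨⟨r, hR hr⟩, hr, Subtype.ext h1⟩

/-- If `W` is fully normalized, and selfcentralizing in `E`, then `N_E(W)` is a localizer
of `W`. -/
theorem IsModel.isLocalizer_groupNormK [Fact p.Prime] (h : IsModel p C τ) {W : Subgroup G}
    (hW : C.IsFullyNormalized W)
    (hc : ∀ e : E, (∀ n : N, (n : G) ∈ W → Commute e (τ n)) → ∃ n : N, (n : G) ∈ W ∧ τ n = e) :
    IsLocalizer p C W hW.1 (groupNormK τ hW.1 ⊤) (groupNormHom h.injective hW.1)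
      (groupNormEnd h.injective hW.1) where
  finite := have := h.finite; inferInstance
  τ_injective := groupNormHom_injective _ _
  sylow := by
    obtain ⟨T, hT⟩ := h.exists_sylow_groupNormK hW.1 hW
    refine ⟨T, ?_⟩
    ext e
    refine (hT e).trans ⟨?_, ?_⟩
    · rintro ⟨y, hy, hye⟩
      exact ⟨⟨y, normK_top N W ▸ hy⟩, Subtype.ext hye⟩
    · rintro ⟨y, rfl⟩
      exact ⟨⟨y, y.2.1⟩, (normK_top N W).symm ▸ y.2, rfl⟩
  range_π φ := by
    have := h.finite_base
    rw [h.induces W W hW.1 hW.1 φ]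
    constructor
    · rintro ⟨e, he⟩
      have he' : e ∈ groupNormK τ hW.1 ⊤ := (mem_groupNormK_top_iff h.injective hW.1).2
        fun n hn => ⟨_, (φ ⟨n, hn⟩).2, he ⟨n, hn⟩⟩
      exact ⟨⟨e, he'⟩, MonoidHom.ext fun q =>
        groupNormAut_apply_eq h.injective hW.1 ⟨e, he'⟩ q (φ q) (he q)⟩
    · rintro ⟨e, rfl⟩
      exact ⟨e, groupNormAut_spec h.injective hW.1 e⟩
  -- The kernel of the action is `C_E(W)`, which `hc` reduces to `Z(W)`.
  ker_π e := by
    constructor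
    · intro he
      have hfix : ∀ q : W, groupNormAut h.injective hW.1 e q = q := fun q =>
        congrArg (fun f : Monoid.End W => (f : W →* W) q) he
      have hcomm : ∀ n : N, (n : G) ∈ W → Commute (e : E) (τ n) := by
        intro n hn
        have h1 := groupNormAut_spec h.injective hW.1 e ⟨n, hn⟩
        simp only [hfix] at h1
        exact mul_inv_eq_iff_eq_mul.1 h1
      obtain ⟨z, hz, hze⟩ := hc e hcomm
      refine ⟨⟨z, z.2, Subgroup.le_normalizer hz⟩, hz, fun w hw => ?_, Subtype.ext hze⟩
      have h1 := (hcomm ⟨w, hW.1 hw⟩ hw).eq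
      rw [← hze, ← map_mul, ← map_mul] at h1
      exact congrArg (fun n : N => (n : G)) (h.injective h1)
    · rintro ⟨z, hz, hzw, rfl⟩
      refine MonoidHom.ext fun q => ?_
      refine groupNormAut_apply_eq h.injective hW.1 _ q q ?_
      rw [coe_groupNormHom, ← map_inv, ← map_mul, ← map_mul]
      congr 1
      refine Subtype.ext ?_
      exact mul_inv_eq_iff_eq_mul.2 (hzw q q.2)
  π_τ y w := by
    have h1 := groupNormAut_spec h.injective hW.1 (groupNormHom h.injective hW.1 y) w
    rw [coe_groupNormHom, ← map_inv, ← map_mul, ← map_mul] at h1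
    exact (congrArg (fun n : N => (n : G)) (h.injective h1)).symm
  coherent e a b ha hab := by
    refine Subtype.ext ((groupNormAut_spec h.injective hW.1 e ⟨a, ha⟩).trans ?_)
    exact congrArg τ (Subtype.ext hab)
  induces T R hT hR φ := by
    have := h.finite_base
    have hTN : T ≤ N := hT.trans inf_le_left
    have hRN : R ≤ N := hR.trans inf_le_left
    have hTW : T ⊔ W ≤ N := sup_le hTN hW.1
    have hRW : R ⊔ W ≤ N := sup_le hRN hW.1
    constructor
    -- An element inducing the extension `ξ` normalizes `W`, since `ξ` stabilizes `W`. Conversely,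
    -- an element of `N_E(W)` carrying `T` into `R` carries `T · W` into `R · W`.
    · rintro ⟨-, -, -, ξ, hξ, hξW, hξφ⟩
      obtain ⟨e, he⟩ := (h.induces _ _ hTW hRW ξ).1 hξ
      have he' : e ∈ groupNormK τ hW.1 ⊤ := (mem_groupNormK_top_iff h.injective hW.1).2
        fun n hn => ⟨_, hξW ⟨n, (le_sup_right : W ≤ T ⊔ W) hn⟩ hn, he ⟨n, _⟩⟩
      refine ⟨⟨e, he'⟩, fun t => Subtype.ext ?_⟩
      refine (he ⟨t, (le_sup_left : T ≤ T ⊔ W) t.2⟩).trans ?_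
      exact congrArg τ (Subtype.ext (hξφ t))
    · rintro ⟨e, he⟩
      have he' : ∀ t : T, (e : E) * τ ⟨t, hTN t.2⟩ * (e : E)⁻¹ = τ ⟨φ t, hRN (φ t).2⟩ :=
        fun t => congrArg Subtype.val (he t)
      have heW := (mem_groupNormK_top_iff h.injective hW.1).1 e.2
      have heTW : (e : E) ∈ groupTransporter τ (T ⊔ W) (R ⊔ W) :=
        groupTransporter_sup hTN hW.1 (fun n hn => ⟨_, (φ ⟨n, hn⟩).2, he' ⟨n, hn⟩⟩) heW
      have spec := groupConj_spec h.injective hTW hRW ⟨e, heTW⟩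
      refine ⟨hT, hR, (h.induces T R hTN hRN φ).2 ⟨e, he'⟩, _,
        h.groupConj_mem hTW hRW ⟨e, heTW⟩, fun w hw => ?_, fun t => ?_⟩
      · obtain ⟨r, hr, h1⟩ := heW ⟨w, hTW w.2⟩ hw
        have h2 := h.injective (h1.symm.trans (spec w))
        rw [h2] at hr
        exact hr
      · exact congrArg (fun n : N => (n : G))
          (h.injective ((spec ⟨t, (le_sup_left : T ≤ T ⊔ W) t.2⟩).symm.trans (he' t)))

/-- Localizers can be transported along group isomorphisms. -/
theorem IsLocalizer.of_mulEquiv [Fact p.Prime] {W : Subgroup G} {hW : W ≤ N} {E' : Type v}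
    [Group E']
    {τ : ↥(normP N W) →* E} {π : E →* Monoid.End W} (h : IsLocalizer p C W hW E τ π)
    {τ' : ↥(normP N W) →* E'} {π' : E' →* Monoid.End W} (f : E' ≃* E)
    (hfτ : ∀ y, f (τ' y) = τ y) (hfπ : ∀ x, π (f x) = π' x) : IsLocalizer p C W hW E' τ' π' where
  finite := have := h.finite; Finite.of_equiv E f.symm.toEquiv
  τ_injective := fun a b hab => h.τ_injective (by rw [← hfτ, ← hfτ, hab])
  sylow := by
    have := h.finite
    obtain ⟨S, hS⟩ := h.sylow
    have hsurj : Function.Surjective f.symm.toMonoidHom := f.symm.surjective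
    refine ⟨S.mapSurjective hsurj, ?_⟩
    rw [Sylow.coe_mapSurjective, hS]
    ext x
    constructor
    · rintro ⟨_, ⟨y, rfl⟩, rfl⟩
      exact ⟨y, f.injective (by simp [hfτ])⟩
    · rintro ⟨y, rfl⟩
      exact ⟨τ y, ⟨y, rfl⟩, f.injective (by simp [hfτ])⟩
  range_π φ := (h.range_π φ).trans
    ⟨fun ⟨e, he⟩ => ⟨f.symm e, by rw [← hfπ, f.apply_symm_apply, he]⟩,
      fun ⟨x, hx⟩ => ⟨f x, by rw [hfπ, hx]⟩⟩
  ker_π e := by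
    rw [← hfπ, h.ker_π]
    simp only [← hfτ, f.injective.eq_iff]
  π_τ y w := by
    rw [← hfπ, hfτ]
    exact h.π_τ y w
  coherent e a b ha hab := f.injective (by
    rw [map_mul, map_mul, map_inv, hfτ, hfτ]
    exact h.coherent (f e) a b ha (by rw [hfπ]; exact hab))
  induces T R hT hR φ := by
    rw [h.induces T R hT hR φ]
    simp only [← hfτ]
    constructor
    · rintro ⟨e, he⟩
      refine ⟨f.symm e, fun t => f.injective ?_⟩
      simpa using he t
    · rintro ⟨x, hx⟩
      refine ⟨f x, fun t => ?_⟩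
      rw [← hx t]
      simp

end Localizer

/-! ### Localities realized by a finite group -/

section Realization

variable {G : Type u} [Group G] {N : Subgroup G} {E : Type v} [Group E] {p : ℕ} {C : PCategory N}
  {τ : N →* E} {Y : Set (Subgroup G)}

/-- An identification of the locality `M` with the transporter of `E` over `Y`. -/
structure Realization (M : Locality.{u, v} C Y) (τ : N →* E) where
  toFun : ∀ {T R : Y}, M.Hom T R → E
  injective : ∀ {T R : Y}, Function.Injective (toFun : M.Hom T R → E)
  surjective : ∀ {T R : Y} (e : E), e ∈ groupTransporter τ (T : Subgroup G) R →
    ∃ x : M.Hom T R, toFun x = e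
  map_comp : ∀ {S T R : Y} (x : M.Hom T R) (y : M.Hom S T),
    toFun (M.comp x y) = toFun x * toFun y
  map_τ : ∀ {T R : Y} (a : transporter N (T : Subgroup G) R),
    toFun (M.τ a) = τ ⟨a, a.2.1⟩
  -- The elements `a`, `b` of `N` are tied to `t` and its image by equations, so no inclusion of the
  -- objects in `N` is needed here.
  conj : ∀ {T R : Y} (x : M.Hom T R) (t : (T : Subgroup G)) (a b : N), (a : G) = t →
    (b : G) = M.π x t → toFun x * τ a * (toFun x)⁻¹ = τ b

namespace Realization

variable {M : Locality.{u, v} C Y}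

theorem map_incl (Φ : Realization M τ) {T R : Y} (h : (T : Subgroup G) ≤ R) :
    Φ.toFun (M.incl h) = 1 :=
  (Φ.map_τ _).trans (map_one τ)

theorem map_id (Φ : Realization M τ) (T : Y) : Φ.toFun (M.id T) = 1 := by
  rw [← M.τ_one]
  exact Φ.map_incl le_rfl

theorem mem_groupTransporter (Φ : Realization M τ) (hY : ∀ T ∈ Y, T ≤ N) {T R : Y} (x : M.Hom T R) :
    Φ.toFun x ∈ groupTransporter τ (T : Subgroup G) R := fun n hn =>
  ⟨⟨M.π x ⟨n, hn⟩, hY R R.2 (M.π x ⟨n, hn⟩).2⟩, (M.π x ⟨n, hn⟩).2,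
    Φ.conj x ⟨n, hn⟩ _ _ rfl rfl⟩

/-- The quotient must correspond to `x⁻¹ y` in `E`; the inclusion of images says exactly that this
element lies in the transporter. -/
theorem isDivisible (Φ : Realization M τ) (hY : ∀ T ∈ Y, T ≤ N) : M.IsDivisible := by
  intro T R Q x y hxy
  have hz : (Φ.toFun x)⁻¹ * Φ.toFun y ∈ groupTransporter τ (T : Subgroup G) R := by
    intro n hn
    obtain ⟨r, hr⟩ := hxy ⟨⟨n, hn⟩, rfl⟩
    have hq := hY Q Q.2 (M.π x r).2
    refine ⟨⟨r, hY R R.2 r.2⟩, r.2, ?_⟩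
    have h1 := Φ.conj x r ⟨r, hY R R.2 r.2⟩ ⟨M.π x r, hq⟩ rfl rfl
    have h2 := Φ.conj y ⟨n, hn⟩ n ⟨M.π x r, hq⟩ rfl (congrArg Subtype.val hr)
    rw [← h2] at h1
    calc _ = (Φ.toFun x)⁻¹ * (Φ.toFun y * τ n * (Φ.toFun y)⁻¹) * Φ.toFun x := by group
      _ = _ := by rw [← h1]; group
  obtain ⟨z, hz⟩ := Φ.surjective _ hz
  refine ⟨z, Φ.injective (by rw [Φ.map_comp, hz, mul_inv_cancel_left]), fun z' hz' => ?_⟩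
  refine Φ.injective ?_
  rw [hz, ← hz', Φ.map_comp, inv_mul_cancel_left]

/-- The group of automorphisms of `Q` is the normalizer of `Q` in `E`. -/
noncomputable def autEquiv (Φ : Realization M τ) [Finite N] (hτ : Function.Injective τ)
    (hY : ∀ T ∈ Y, T ≤ N) (Q : Y) :
    M.Aut Q ≃* groupNormK τ (hY Q Q.2) ⊤ :=
  MulEquiv.ofBijective (MonoidHom.mk' (fun x => ⟨Φ.toFun (x : M.Hom Q Q),
    (mem_groupNormK_top_iff hτ (hY Q Q.2)).2 (Φ.mem_groupTransporter hY _)⟩)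
    (fun a b => Subtype.ext (Φ.map_comp _ _))) (by
    constructor
    · intro a b hab
      exact Units.ext (Φ.injective (congrArg Subtype.val hab))
    · intro e
      obtain ⟨x, hx⟩ := Φ.surjective (T := Q) (R := Q) _
        ((mem_groupNormK_top_iff hτ (hY Q Q.2)).1 e.2)
      obtain ⟨y, hy⟩ := Φ.surjective (T := Q) (R := Q) _
        ((mem_groupNormK_top_iff hτ (hY Q Q.2)).1 (e⁻¹).2)
      -- Automorphisms are units of the endomorphism monoid, so the inverse of `e` is lifted as
      -- well.
      refine ⟨⟨x, y, Φ.injective ?_, Φ.injective ?_⟩, Subtype.ext hx⟩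
      · refine (Φ.map_comp x y).trans (Eq.trans ?_ (Φ.map_id Q).symm)
        rw [hx, hy, Subgroup.coe_inv, mul_inv_cancel]
      · refine (Φ.map_comp y x).trans (Eq.trans ?_ (Φ.map_id Q).symm)
        rw [hx, hy, Subgroup.coe_inv, inv_mul_cancel])

/-- A locality realized by a model in which the fully normalized objects are selfcentralizing is
perfect. -/
theorem isPerfect (Φ : Realization M τ) [Fact p.Prime] (h : IsModel p C τ) (hY : ∀ T ∈ Y, T ≤ N)
    (hc : ∀ Q ∈ Y, ∀ e : E, (∀ n : N, (n : G) ∈ Q → Commute e (τ n)) →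
      ∃ n : N, (n : G) ∈ Q ∧ τ n = e) : M.IsPerfect p where
  divisible := Φ.isDivisible hY
  localizer Q hQ := by
    have := h.finite_base
    refine (h.isLocalizer_groupNormK hQ (hc Q Q.2)).of_mulEquiv (Φ.autEquiv h.injective hY Q) ?_ ?_
    · intro y
      exact Subtype.ext (Φ.map_τ _)
    · intro x
      refine MonoidHom.ext fun q => ?_
      exact groupNormAut_apply_eq h.injective hQ.1 _ q _ (Φ.conj _ q _ _ rfl rfl)

/-- Inclusions correspond to `1`, so extending a morphism does not change its element of `E`. Hence
a morphism normalizes `W` precisely when its element normalizes `τ(W)`. -/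
theorem map_eq_of_comp_incl (Φ : Realization M τ) {T R T' R' : Y} {x : M.Hom T R} {x' : M.Hom T' R'}
    {hT : (T : Subgroup G) ≤ T'} {hR : (R : Subgroup G) ≤ R'} :
    M.comp x' (M.incl hT) = M.comp (M.incl hR) x ↔ Φ.toFun x' = Φ.toFun x := by
  rw [← (Φ.injective (T := T) (R := R')).eq_iff, Φ.map_comp, Φ.map_comp, Φ.map_incl, Φ.map_incl,
    mul_one, one_mul]

/-- The normalizer of `W` in a locality realized by `E` is realized by `N_E(W)`. -/
def normalizer (Φ : Realization M τ) [Finite N] (hτ : Function.Injective τ)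
    (hY : C.IsUpClosed Y) (hM : M.IsDivisible)
    {W : Subgroup G} (hW : W ≤ N) :
    Realization (M.normalizer hY hM W hW) (groupNormHom hτ hW) where
  toFun {T R} x := ⟨Φ.toFun x.1, by
    obtain ⟨x', hx', hxx'⟩ := x.2
    rw [mem_groupNormK_top_iff hτ hW, ← Φ.map_eq_of_comp_incl.1 hxx']
    intro n hn
    have hnT : (n : G) ∈ (T : Subgroup G) ⊔ W := (le_sup_right : W ≤ (T : Subgroup G) ⊔ W) hn
    exact ⟨⟨M.π x' ⟨n, hnT⟩, hW (hx' _ hn)⟩, hx' _ hn, Φ.conj x' ⟨n, hnT⟩ _ _ rfl rfl⟩⟩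
  injective := fun {_ _} x y hxy => Subtype.ext (Φ.injective (congrArg Subtype.val hxy))
  surjective := fun {T R} e he => by
    have hTN : (T : Subgroup G) ≤ N := T.2.2.trans inf_le_left
    have hRN : (R : Subgroup G) ≤ N := R.2.2.trans inf_le_left
    have heW := (mem_groupNormK_top_iff hτ hW).1 e.2
    have heT := (mem_groupTransporter_groupNormHom_iff hτ hW T.2.2 R.2.2 e).1 he
    obtain ⟨x, hx⟩ := Φ.surjective (T := Locality.obj T) (R := Locality.obj R) (e : E) heT
    -- The same element, which normalizes `W`, also carries `T · W` into `R · W` and so provides the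
    -- extension stabilizing `W`.
    obtain ⟨x', hx'⟩ := Φ.surjective (T := Locality.objSup hY hW T)
      (R := Locality.objSup hY hW R) (e : E) (groupTransporter_sup hTN hW heT heW)
    refine ⟨⟨x, x', fun w hw => ?_, Φ.map_eq_of_comp_incl.2 (hx'.trans hx.symm)⟩, Subtype.ext hx⟩
    obtain ⟨r, hr, h1⟩ := heW ⟨w, hW hw⟩ hw
    have h2 := Φ.conj x' w ⟨w, hW hw⟩ ⟨M.π x' w, sup_le hRN hW (M.π x' w).2⟩ rfl rfl
    rw [hx', h1] at h2
    rw [hτ h2] at hr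
    exact hr
  map_comp x y := Subtype.ext (Φ.map_comp _ _)
  map_τ a := Subtype.ext (Φ.map_τ _)
  conj x t a b ha hb := Subtype.ext (Φ.conj x.1 t ⟨a, a.2.1⟩ ⟨b, b.2.1⟩ ha hb)

end Realization

section Iso

variable {P : Subgroup G} {F : PCategory P} {W : Subgroup G} {hW : W ≤ P}
  {τ : ↥(normP P W) →* E} {π : E →* Monoid.End W} {M : Locality.{u, v} (F.normalizer W hW) Y}

/-- An isomorphism with the transporter of a localizer is a realization. -/
def Locality.Iso.realization {h : IsLocalizer p F W hW E τ π} {hY : ∀ T ∈ Y, T ≤ normP P W}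
    (I : Locality.Iso M (transporterLocality h Y hY)) : Realization M τ where
  toFun {T R} x := Subtype.val (p := (· ∈ groupTransporter τ (T : Subgroup G) R)) (I.equiv T R x)
  injective {T R} := Subtype.val_injective.comp (I.equiv T R).injective
  surjective {T R} e he := ⟨(I.equiv T R).symm ⟨e, he⟩,
    congrArg Subtype.val ((I.equiv T R).apply_symm_apply ⟨e, he⟩)⟩
  map_comp x y := congrArg Subtype.val (I.map_comp x y)
  map_τ a := congrArg Subtype.val (I.map_τ a)
  conj {T R} x t a b ha hb := by
    have h1 := groupConj_spec h.τ_injective (hY T T.2) (hY R R.2) (I.equiv T R x) t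
    have h2 : groupConj h.τ_injective (hY T T.2) (I.equiv T R x) = M.π x := I.π_map x
    rw [h2] at h1
    have ha' : a = ⟨t, hY T T.2 t.2⟩ := Subtype.ext ha
    have hb' : b = ⟨M.π x t, hY R R.2 (M.π x t).2⟩ := Subtype.ext hb
    rw [ha', hb']
    exact h1

/-- A locality realized by a localizer is isomorphic to its transporter. -/
noncomputable def Realization.iso (Φ : Realization M τ) (h : IsLocalizer p F W hW E τ π)
    (hY : ∀ T ∈ Y, T ≤ normP P W) : Locality.Iso M (transporterLocality h Y hY) where
  equiv T R := Equiv.ofBijective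
    (fun x => (⟨Φ.toFun x, Φ.mem_groupTransporter hY x⟩ : groupTransporter τ (T : Subgroup G) R))
    ⟨fun x y hxy => Φ.injective (congrArg Subtype.val hxy), fun e => by
      obtain ⟨x, hx⟩ := Φ.surjective e.1 e.2
      exact ⟨x, Subtype.ext hx⟩⟩
  map_id Q := Subtype.ext (Φ.map_id Q)
  map_comp x y := Subtype.ext (Φ.map_comp x y)
  map_τ a := Subtype.ext (Φ.map_τ a)
  π_map {T R} x := groupConj_unique h.τ_injective (hY T T.2) (hY R R.2) _ _
    (fun t => Φ.conj x t _ _ rfl rfl)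

end Iso

/-- A locality realized by a model in which all selfcentralizing subgroups are selfcentralizing in
the group is extendable. -/
theorem Realization.isExtendable [Fact p.Prime] {M : Locality.{u, v} C Y} (Φ : Realization M τ)
    (h : IsModel p C τ) (hY : C.IsUpClosed Y) (hM : M.IsPerfect p)
    (hc : ∀ W, C.IsSelfcentralizing W → ∀ e : E,
      (∀ n : N, (n : G) ∈ W → Commute e (τ n)) → ∃ n : N, (n : G) ∈ W ∧ τ n = e) :
    M.IsExtendable hY hM := by
  intro W hW hWn _
  have := h.finite_base
  -- The localizer of `W` is `N_E(W)`, which also realizes the normalizer of `W` in `M`.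
  exact ⟨_, _, _, _, h.isLocalizer_groupNormK hWn (hc W hW),
    ⟨(Φ.normalizer h.injective hY hM.divisible hW.1).iso _ _⟩⟩

end Realization

/-! ### Objects and centralizers for the normalizer of `V` -/

/-- The members of `X` contained in `N_P(V)` form a set of `N_F(V)`-selfcentralizing subgroups
closed under `N_F(V)`-morphisms. -/
theorem PCategory.IsUpClosed.objNorm {G : Type u} [Group G] {P : Subgroup G} {F : PCategory P}
    {X : Set (Subgroup G)} (hX : F.IsUpClosed X) {V : Subgroup G} (hV : V ≤ P)
    (hVX : normP P V ∈ X) : (F.normalizer V hV).IsUpClosed (objNorm P X V) where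
  nonempty := ⟨_, hVX, le_rfl⟩
  selfcentralizing Q hQ := by
    refine ⟨hQ.2, fun φ hφ y hy => ?_⟩
    -- A morphism into `N_P(V)` followed by the inclusion into `P` is an `F`-morphism, and a
    -- centralizer in `N_P(V)` is contained in the one in `P`.
    have hincl := F.conj_mem (inf_le_left : normP P V ≤ P) le_rfl
      ⟨1, one_mem_transporter inf_le_left⟩
    have happ : ∀ n : ↥(normP P V), (conjHom (P := P) ⟨1, one_mem_transporter
        (inf_le_left : normP P V ≤ P)⟩ n : G) = n := fun n => by simp [conjHom]
    obtain ⟨q, hq⟩ := (hX.selfcentralizing Q hQ.1).2 _ (F.comp_mem hincl hφ.2.2.1) ⟨y, y.2.1⟩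
      (fun q => Subtype.ext (by
        have h1 : (y : G) * φ q = φ q * y := congrArg Subtype.val (hy q)
        rw [← happ (φ q)] at h1
        exact h1))
    refine ⟨q, Subtype.ext ?_⟩
    rw [← happ]
    exact congrArg Subtype.val hq
  up Q hQ R φ hφ := ⟨hX.up Q hQ.1 R φ hφ.2.2.1, hφ.2.1⟩

/-- The subgroups of `N_P(V)` that are `N_F(V)`-selfcentralizing are selfcentralizing in a localizer
of `V`. -/
theorem IsLocalizer.centralizer_le_image {p : ℕ} [Fact p.Prime] {G : Type u} [Group G]
    {P : Subgroup G} {F : PCategory P} {V : Subgroup G} {hV : V ≤ P} {E : Type v} [Group E]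
    {τ : ↥(normP P V) →* E} {π : E →* Monoid.End V} (h : IsLocalizer p F V hV E τ π)
    {W : Subgroup G} (hW : (F.normalizer V hV).IsSelfcentralizing W) {e : E}
    (he : ∀ n : ↥(normP P V), (n : G) ∈ W → Commute e (τ n)) :
    ∃ n : ↥(normP P V), (n : G) ∈ W ∧ τ n = e := by
  have hVN : V ≤ normP P V := le_inf hV Subgroup.le_normalizer
  refine h.isModel.centralizer_le_image hVN (fun e n hn => ?_) (fun e he => ?_) hW he
  -- By coherence `E` normalizes `τ(V)`. In the second goal, an element centralizing `τ(V)` lies in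
  -- the kernel of `π`, which is `τ(Z(V))`.
  · exact ⟨⟨(π e : V →* V) ⟨n, hn⟩, hVN ((π e : V →* V) ⟨n, hn⟩).2⟩,
      ((π e : V →* V) ⟨n, hn⟩).2, h.coherent e n _ hn rfl⟩
  · obtain ⟨z, -, -, hz⟩ := (h.ker_π e).1 (MonoidHom.ext fun v => by
      have h1 := h.coherent e ⟨v, hVN v.2⟩
        ⟨(π e : V →* V) v, hVN ((π e : V →* V) v).2⟩ v.2 rfl
      rw [(he ⟨v, hVN v.2⟩ v.2).eq, mul_inv_cancel_right] at h1
      exact Subtype.ext (congrArg Subtype.val (h.τ_injective h1)).symm)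
    exact ⟨z, hz⟩

end Puig

theorem proposition2p7 {p : ℕ} [Fact p.Prime] {G : Type u} [Group G] {P : Subgroup G} [Finite P]
    (hP : IsPGroup p P) (F : Puig.PCategory P) (hF : F.IsFrobenius p)
    (X : Set (Subgroup G)) (hX : F.IsUpClosed X)
    (L : Puig.Locality.{u, v} F X) (hL : L.IsPerfect p) (hLext : L.IsExtendable hX hL)
    (V : Subgroup G) (hV : F.IsSelfcentralizing V) (hVn : F.IsFullyNormalized V)
    (hVX : Puig.normP P V ∈ X) :
    (F.normalizer V hV.1).IsFrobenius p ∧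
    ∃ (hXV : (F.normalizer V hV.1).IsUpClosed (Puig.objNorm P X V))
      (hLV : (L.normalizer hX hL.divisible V hV.1).IsPerfect p),
      (L.normalizer hX hL.divisible V hV.1).IsExtendable hXV hLV := by
  -- Extendability is applied to `W = V`; all three conclusions are then read off from the localizer
  -- `E`.
  obtain ⟨E, _, τ, π, h, ⟨I⟩⟩ := hLext V hV hVn hVX
  have hXV := hX.objNorm hV.1 hVX
  have hLV := I.realization.isPerfect h.isModel (fun _ hT => hT.2)
    (fun Q hQ e he => h.centralizer_le_image (hXV.selfcentralizing Q hQ) he)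
  exact ⟨h.isModel.isFrobenius, hXV, hLV, I.realization.isExtendable h.isModel hXV hLV
    (fun W hW e he => h.centralizer_le_image hW he)⟩
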